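/- Let $(X,d,(\alpha_i)_{i\in\mathbb N})$ be a computable metric space with $d$ bounded: $(X,d)$ is a complete metric space, $(\alpha_i)$ is a dense sequence in $X$ (the special points), and the reals $d(\alpha_i,\alpha_j)$ are computable uniformly in $i,j$. Let $\mathcal P(X)$ be the set of Borel probability measures on $X$ with the Prokhorov metric $\pi$, and let $(\delta_i)_{i\in\mathbb N}$ be an effective enumeration of the probability measures concentrated on finitely many special points and assigning rational masses to them. A Cauchy name of $\mu\in\mathcal P(X)$ is a sequence $g:\mathbb N\to\mathbb N$ with $\pi(\delta_{g(n)},\mu)\le 2^{-n}$ for all $n$. For an integer $p\ge 1$ let $$\mathbb I_p(\mu,\nu)=\inf_{\gamma\in\Pi(\mu,\nu)}\int_{X\times X} d(x,y)^p\,d\gamma(x,y),$$ where $\Pi(\mu,\nu)$ is the set of probability measures on $X\times X$ with marginals $\mu$ and $\nu$. Then $\mathbb I_p(\mu,\nu)$ is computable uniformly in $\mu$, $\nu$ and $p$: there is a single oracle algorithm which, for all integers $p\ge 1$ and $n\ge 0$, all $\mu,\nu\in\mathcal P(X)$ and all Cauchy names $g$ of $\mu$ and $h$ of $\nu$, on input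 $(p,n)$ with oracles $g$ and $h$ halts and outputs (a code of) a rational number $q$ with $|q-\mathbb I_p(\mu,\nu)|\le 2^{-n}$. -/

import Mathlib

open MeasureTheory

namespace UniformTransport

/-! ### Computability relative to oracles, uniformly in the oracles -/

/-- The partial recursive functionals with `k` oracles: the least class of maps
`F : (Fin k → ℕ → ℕ) → (ℕ →. ℕ)` that contains zero, successor, the projections of the pairing
function and the calls to each oracle, and is closed under pairing, composition, primitive recursion
and unbounded search.  One derivation (that is, one program) works for all oracles `g`
simultaneously; `F g n` is the result of the program on input `n` with oracles `g`. -/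
inductive RecursiveFunctional {k : ℕ} : ((Fin k → ℕ → ℕ) → ℕ →. ℕ) → Prop
  | zero : RecursiveFunctional fun _ _ => Part.some 0
  | succ : RecursiveFunctional fun _ n => Part.some (n + 1)
  | left : RecursiveFunctional fun _ n => Part.some (Nat.unpair n).1
  | right : RecursiveFunctional fun _ n => Part.some (Nat.unpair n).2
  | oracle (i : Fin k) : RecursiveFunctional fun g n => Part.some (g i n)
  | pair {F H : (Fin k → ℕ → ℕ) → ℕ →. ℕ} (hF : RecursiveFunctional F)
      (hH : RecursiveFunctional H) :
      RecursiveFunctional fun g n => Nat.pair <$> F g n <*> H g n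
  | comp {F H : (Fin k → ℕ → ℕ) → ℕ →. ℕ} (hF : RecursiveFunctional F)
      (hH : RecursiveFunctional H) :
      RecursiveFunctional fun g n => H g n >>= F g
  | prec {F H : (Fin k → ℕ → ℕ) → ℕ →. ℕ} (hF : RecursiveFunctional F)
      (hH : RecursiveFunctional H) :
      RecursiveFunctional fun g m =>
        Nat.rec (motive := fun _ => Part ℕ) (F g (Nat.unpair m).1)
          (fun y IH => IH >>= fun i => H g (Nat.pair (Nat.unpair m).1 (Nat.pair y i)))
          (Nat.unpair m).2
  | rfind {F : (Fin k → ℕ → ℕ) → ℕ →. ℕ} (hF : RecursiveFunctional F) :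
      RecursiveFunctional fun g a =>
        Nat.rfind fun n => (fun m => decide (m = 0)) <$> F g (Nat.pair a n)

/-- The standard numbering of the rational numbers: a code of the triple `(a, b, c)` of natural
numbers stands for `(a - b) / (c + 1)`. -/
def ratOfCode (e : ℕ) : ℚ :=
  let t := Denumerable.ofNat (ℕ × ℕ × ℕ) e
  ((t.1 : ℚ) - t.2.1) / (t.2.2 + 1)

/-! ### Computable metric spaces -/

/-- `(X, d, α)` is a computable metric space: the sequence `α` of special points is dense, and the
distances `d (α i) (α j)` are real numbers computable uniformly in `i` and `j`.
(Completeness of `X` is stated separately.) -/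
structure IsComputableMetricSpace {X : Type*} [MetricSpace X] (α : ℕ → X) : Prop where
  dense : DenseRange α
  computable_dist : ∃ f : ℕ × ℕ × ℕ → ℕ, Computable f ∧
    ∀ i j n : ℕ, |(ratOfCode (f (i, j, n)) : ℝ) - dist (α i) (α j)| ≤ (2 : ℝ)⁻¹ ^ n

section Measures

variable {X : Type*} [MeasurableSpace X]

/-- The measure `∑ (w + 1) • δ_{α i}`, where `(w, i)` runs through the entries of a list. -/
noncomputable def weightedSum (α : ℕ → X) (l : List (ℕ × ℕ)) : Measure X :=
  (l.map fun e => ((e.1 + 1 : ℕ) : ENNReal) • Measure.dirac (α e.2)).sum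

/-- The sum of the weights `w + 1` of a list of pairs `(w, i)`. -/
def totalWeight (l : List (ℕ × ℕ)) : ℕ :=
  (l.map fun e => e.1 + 1).sum

/-- The effective enumeration of the probability measures concentrated on finitely many special
points and giving them rational masses: `n` codes a nonempty list of pairs `(w, i)`, and
`idealMeasure α n` gives each `α i` a mass proportional to the sum of the `w + 1` over the entries
`(w, i)` of the list. -/
noncomputable def idealMeasure (α : ℕ → X) (n : ℕ) : Measure X :=
  let t := Denumerable.ofNat ((ℕ × ℕ) × List (ℕ × ℕ)) n
  ((totalWeight (t.1 :: t.2) : ℕ) : ENNReal)⁻¹ • weightedSum α (t.1 :: t.2)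

lemma weightedSum_univ (α : ℕ → X) (l : List (ℕ × ℕ)) :
    weightedSum α l Set.univ = ((totalWeight l : ℕ) : ENNReal) := by
  induction l with
  | nil => simp [weightedSum, totalWeight]
  | cons e l ih =>
    simp only [weightedSum, totalWeight, List.map_cons, List.sum_cons, Measure.add_apply,
      Measure.smul_apply, measure_univ, smul_eq_mul, mul_one, Nat.cast_add] at ih ⊢
    rw [ih]

instance (α : ℕ → X) (n : ℕ) : IsProbabilityMeasure (idealMeasure α n) := by
  constructor
  simp only [idealMeasure, Measure.smul_apply, weightedSum_univ, smul_eq_mul]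
  apply ENNReal.inv_mul_cancel
  · simp [totalWeight]
  · exact ENNReal.natCast_ne_top _

/-- `g` is a Cauchy name of `μ` in the space of probability measures with the (Lévy–)Prokhorov
metric and the special points `idealMeasure α n`: the special point number `g n` is within `2⁻ⁿ` of
`μ`, for every `n`. -/
def IsCauchyName [PseudoEMetricSpace X] (α : ℕ → X) (μ : ProbabilityMeasure X) (g : ℕ → ℕ) : Prop :=
  ∀ n : ℕ, levyProkhorovDist (idealMeasure α (g n)) (μ : Measure X) ≤ (2 : ℝ)⁻¹ ^ n

/-- The transference plans: probability measures on `X × X` with marginals `μ` and `ν`. -/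
def transferencePlans (μ ν : ProbabilityMeasure X) : Set (ProbabilityMeasure (X × X)) :=
  {γ | (γ : Measure (X × X)).fst = (μ : Measure X) ∧ (γ : Measure (X × X)).snd = (ν : Measure X)}

/-- The optimal transport cost between `μ` and `ν` for the cost function `c`.  (The set of plans is
never empty, as it contains the product measure; it is used below for bounded continuous `c ≥ 0`,
for which all the integrals exist.) -/
noncomputable def optimalCost (c : X → X → ℝ) (μ ν : ProbabilityMeasure X) : ℝ :=
  sInf ((fun γ : ProbabilityMeasure (X × X) => ∫ z, c z.1 z.2 ∂(γ : Measure (X × X))) ''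
    transferencePlans μ ν)

end Measures

end UniformTransport

namespace UniformTransport

/-! ### Oracle programs from partial recursive functions -/

namespace RecursiveFunctional

/-! The optimal cost is stable under Prokhorov perturbation, with an explicit modulus. It therefore
suffices to query each name once, at a precision computed from the input, and to solve exactly a
finite transport problem with rational costs.

Repeating atoms turns the two ideal measures into uniform measures on families `x`, `y` of the same
size N. Prokhorov closeness of μ to the uniform measure on `x` is a Hall condition with deficiency,
so μ splits into N pieces of mass 1/N, the k-th lying near `x k` on average
(`exists_isSplitting_of_levyProkhorovDist_lt`, by way of `exists_matching`). The same holds for ν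
and `y`.

For a bounded Lipschitz cost, splittings compare transport with assignment
(`abs_optimalCost_sub_le`). A permutation gives a plan that couples matched pieces independently.
Conversely, a plan gives a doubly stochastic matrix of masses between pieces, and by Birkhoff's
theorem its cost is at least that of the best permutation. No optimal plan is needed, and the cost
d^p is Lipschitz because d is bounded.

The assignment problem is solved by exhaustive search over natural-number costs, namely rounded
distances raised to the power p (`isLeast_assignmentMin`). `error_le` adds up the errors. -/

theorem of_partrec {k : ℕ} {f : ℕ →. ℕ} (hf : Nat.Partrec f) :
    RecursiveFunctional fun _ : Fin k → ℕ → ℕ => f := by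
  induction hf with
  | zero => exact zero
  | succ => exact succ
  | left => exact left
  | right => exact right
  | pair _ _ ihf ihg => exact pair ihf ihg
  | comp _ _ ihf ihg => exact comp ihf ihg
  | prec _ _ ihf ihg => exact prec ihf ihg
  | rfind _ ihf => exact rfind ihf

theorem of_computable {k : ℕ} {f : ℕ → ℕ} (hf : Computable f) :
    RecursiveFunctional fun (_ : Fin k → ℕ → ℕ) n => Part.some (f n) :=
  of_partrec (Partrec.nat_iff.1 hf)

/-- A program that queries each of two oracles once, at a place computed from the input, and then
applies a computable function to the input and the two answers. -/
theorem of_two_queries {f : ℕ × ℕ × ℕ → ℕ} {m : ℕ → ℕ} (hf : Computable f)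
    (hm : Computable m) :
    RecursiveFunctional fun (g : Fin 2 → ℕ → ℕ) a =>
      Part.some (f (a, g 0 (m a), g 1 (m a))) := by
  have hf' : Computable fun n : ℕ =>
      f (n.unpair.1, n.unpair.2.unpair.1, n.unpair.2.unpair.2) := by
    have hu : Computable Nat.unpair := Computable.unpair
    exact hf.comp ((Computable.fst.comp hu).pair (hu.comp (Computable.snd.comp hu)))
  have hq (i : Fin 2) : RecursiveFunctional fun (g : Fin 2 → ℕ → ℕ) a =>
      Part.some (g i (m a)) := by
    convert comp (oracle i) (of_computable hm) using 3
    simp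
  convert comp (of_computable hf') (pair (of_computable Computable.id) (pair (hq 0) (hq 1)))
    using 3
  simp [Seq.seq]

end RecursiveFunctional

/-! ### Fractional matchings -/

/-- A fractional form of Hall's marriage theorem with deficiency `δ`: the uniform weights on `ι` can
be matched with the weights `b` along the relation `R`, up to a mass `δ + ε`. -/
theorem exists_partial_matching {ι κ : Type*} [Fintype ι] [Fintype κ] [Nonempty ι]
    {b : κ → ℝ} (hb : ∀ j, 0 ≤ b j) {R : ι → κ → Prop} {δ ε : ℝ} (hδ : 0 ≤ δ)
    (hε : 0 < ε)
    (hall : ∀ S : Finset ι, (S.card : ℝ) / Fintype.card ι ≤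
      (∑ j, open Classical in if ∃ i ∈ S, R i j then b j else 0) + δ) :
    ∃ f : ι → κ → ℝ, (∀ i j, 0 ≤ f i j) ∧ (∀ i j, ¬ R i j → f i j = 0) ∧
      (∀ i, ∑ j, f i j ≤ 1 / Fintype.card ι) ∧ (∀ j, ∑ i, f i j ≤ b j) ∧
      1 - δ - ε ≤ ∑ i, ∑ j, f i j := by
  classical
  set N := Fintype.card ι with hN
  have hN0 : (0 : ℝ) < N := by exact_mod_cast Fintype.card_pos
  -- Each `i` is split into K equal copies, so one copy has mass 1/M with M = N * K. This K is large
  -- enough for the rounding loss, at most card κ + 1 copies, to have mass at most ε.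
  obtain ⟨K, hK⟩ := exists_nat_gt (((Fintype.card κ : ℝ) + 1) / ε)
  have hK0 : (0 : ℝ) < K := lt_of_le_of_lt (by positivity) hK
  have hN1 : (1 : ℝ) ≤ N := by exact_mod_cast Fintype.card_pos
  set M : ℝ := N * K with hM
  have hM0 : 0 < M := by positivity
  let n : κ → ℕ := fun j => ⌊M * b j⌋₊
  -- Number of dummy partners: M * δ for the deficiency, and one per `j` for rounding M * b j down.
  let d : ℕ := ⌈Fintype.card κ + M * δ⌉₊
  have hd : (d : ℝ) ≤ M * (δ + ε) := by
    have h1 : (d : ℝ) < Fintype.card κ + M * δ + 1 := Nat.ceil_lt_add_one (by positivity)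
    have h2 : (Fintype.card κ : ℝ) + 1 < K * ε := (div_lt_iff₀ hε).1 hK
    have h3 : K * ε ≤ M * ε := by
      rw [hM, mul_assoc]
      exact le_mul_of_one_le_left (by positivity) hN1
    linarith
  let h : (Σ j, Fin (n j)) ⊕ Fin d → Option κ := Sum.elim (fun s => some s.1) fun _ => none
  -- Dummies have `h y = none`, so they satisfy the condition vacuously and are adjacent to every
  -- copy.
  let t : ι × Fin K → Finset ((Σ j, Fin (n j)) ⊕ Fin d) := fun x =>
    Finset.univ.filter fun y => ∀ j, h y = some j → R x.1 j
  have key : ∀ s : Finset (ι × Fin K), s.card ≤ (s.biUnion t).card := by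
    intro s
    rcases s.eq_empty_or_nonempty with rfl | ⟨x₀, hx₀⟩
    · simp
    let S := s.image Prod.fst
    let Q : Finset κ := Finset.univ.filter fun j => ∃ i ∈ S, R i j
    have h1 : s.card ≤ S.card * K := by
      have : s ⊆ S ×ˢ Finset.univ := fun x hx => by
        simpa [S] using ⟨x.2, hx⟩
      simpa using Finset.card_le_card this
    have h2 : (Q.sigma fun j => (Finset.univ : Finset (Fin (n j)))).disjSum
        (Finset.univ : Finset (Fin d)) ⊆ s.biUnion t := by
      intro y hy
      rcases y with ⟨j, c⟩ | c
      · simp only [Finset.inl_mem_disjSum, Finset.mem_sigma, Finset.mem_univ, and_true, Q,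
          Finset.mem_filter, true_and, S, Finset.mem_image] at hy
        obtain ⟨i, ⟨x, hx, rfl⟩, hR⟩ := hy
        simp only [Finset.mem_biUnion, t, Finset.mem_filter, Finset.mem_univ, true_and]
        exact ⟨x, hx, fun j' hj' => by
          simp only [h, Sum.elim_inl, Option.some.injEq] at hj'
          exact hj' ▸ hR⟩
      · simp only [Finset.mem_biUnion, t, Finset.mem_filter, Finset.mem_univ, true_and]
        exact ⟨x₀, hx₀, fun j' hj' => by simp [h] at hj'⟩
    have h3 := Finset.card_le_card h2
    rw [Finset.card_disjSum, Finset.card_sigma] at h3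
    simp only [Finset.card_univ, Fintype.card_fin] at h3
    refine le_trans ?_ h3
    have h4 := hall S
    rw [div_le_iff₀ hN0, ← Finset.sum_filter] at h4
    have h5 : M * ∑ j ∈ Q, b j ≤ ∑ j ∈ Q, (n j : ℝ) + Fintype.card κ := by
      rw [Finset.mul_sum]
      calc ∑ j ∈ Q, M * b j ≤ ∑ j ∈ Q, ((n j : ℝ) + 1) :=
            Finset.sum_le_sum fun j _ => (Nat.lt_floor_add_one _).le
        _ ≤ _ := by
            rw [Finset.sum_add_distrib]
            simp only [Finset.sum_const, nsmul_eq_mul, mul_one]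
            gcongr
            exact Finset.card_le_univ Q
    have h6 : (Fintype.card κ : ℝ) + M * δ ≤ d := Nat.le_ceil _
    have h7 : (S.card : ℝ) * K ≤ M * ∑ j ∈ Q, b j + M * δ := by
      calc (S.card : ℝ) * K ≤ ((∑ j ∈ Q, b j + δ) * N) * K := by gcongr
        _ = _ := by rw [hM]; ring
    have h8 : (s.card : ℝ) ≤ S.card * K := by exact_mod_cast h1
    have : (s.card : ℝ) ≤ ((∑ j ∈ Q, n j + d : ℕ) : ℝ) := by
      push_cast
      linarith
    exact_mod_cast this
  obtain ⟨g, hg, hgt⟩ := (Finset.all_card_le_biUnion_card_iff_exists_injective t).1 key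
  -- Hall's theorem gives an injection `g`. The flow from `i` to `j` is the number of copies of `i`
  -- sent to copies of `j`, divided by M; the value `none` counts the copies lost to dummies.
  let cnt : ι → Option κ → ℕ := fun i o =>
    ((Finset.univ : Finset (Fin K)).filter fun a => h (g (i, a)) = o).card
  have hcnt (i : ι) : cnt i none + ∑ j, cnt i (some j) = K := by
    rw [← Fintype.sum_option (cnt i)]
    simpa using (Finset.card_eq_sum_card_fiberwise (f := fun a => h (g (i, a)))
      (s := Finset.univ) (t := Finset.univ) (by simp)).symm
  have htot (o : Option κ) : ∑ i, cnt i o ≤ (Finset.univ.filter fun y => h y = o).card := by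
    have h1 : ∑ i, cnt i o =
        ((Finset.univ : Finset (ι × Fin K)).filter fun x => h (g x) = o).card := by
      simp only [cnt, Finset.card_filter, Fintype.sum_prod_type]
    rw [h1]
    exact Finset.card_le_card_of_injOn g (by intro x; simp) hg.injOn
  have hsome (j : κ) : ∑ i, cnt i (some j) ≤ n j := by
    refine (htot _).trans ?_
    have : (Finset.univ.filter fun y => h y = some j) ⊆
        Finset.univ.image fun c : Fin (n j) => Sum.inl (Sigma.mk j c) := by
      intro y hy
      rcases y with ⟨j', c⟩ | c
      · simp only [Finset.mem_filter, Finset.mem_univ, true_and, h, Sum.elim_inl,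
          Option.some.injEq] at hy
        subst hy
        simp
      · simp [h] at hy
    refine (Finset.card_le_card this).trans (Finset.card_image_le.trans (by simp))
  have hnone : ∑ i, cnt i none ≤ d := by
    refine (htot _).trans ?_
    have : (Finset.univ.filter fun y => h y = none) ⊆
        Finset.univ.image fun c : Fin d => Sum.inr c := by
      intro y hy
      rcases y with ⟨j', c⟩ | c
      · simp [h] at hy
      · simp
    refine (Finset.card_le_card this).trans (Finset.card_image_le.trans (by simp))
  refine ⟨fun i j => cnt i (some j) / M, fun i j => by positivity, ?_, ?_, ?_, ?_⟩
  · intro i j hR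
    have : cnt i (some j) = 0 := by
      simp only [cnt, Finset.card_eq_zero, Finset.filter_eq_empty_iff]
      intro a _ ha
      have := hgt (i, a)
      simp only [t, Finset.mem_filter, Finset.mem_univ, true_and] at this
      exact hR (this j ha)
    simp [this]
  · intro i
    rw [← Finset.sum_div, div_le_div_iff₀ hM0 hN0, hM]
    have : ((∑ j, cnt i (some j) : ℕ) : ℝ) ≤ K := by
      exact_mod_cast (hcnt i) ▸ Nat.le_add_left _ _
    push_cast at this
    nlinarith
  · intro j
    rw [← Finset.sum_div, div_le_iff₀ hM0, mul_comm]
    have : ((∑ i, cnt i (some j) : ℕ) : ℝ) ≤ n j := by exact_mod_cast hsome j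
    push_cast at this
    exact this.trans (Nat.floor_le (mul_nonneg hM0.le (hb j)))
  · simp only [← Finset.sum_div]
    rw [le_div_iff₀ hM0]
    have h1 : ((∑ i, cnt i none : ℕ) : ℝ) + ∑ i, ∑ j, (cnt i (some j) : ℝ) = M := by
      have : ∑ i, cnt i none + ∑ i, ∑ j, cnt i (some j) = N * K := by
        rw [← Finset.sum_add_distrib]
        simp [hcnt, hN]
      rw [hM]
      exact_mod_cast this
    have h2 : ((∑ i, cnt i none : ℕ) : ℝ) ≤ d := by exact_mod_cast hnone
    nlinarith

/-- Under the hypotheses of `exists_partial_matching`, there is a coupling of the uniform weights on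
`ι` with the weights `b` whose mass outside of `R` is at most `δ + ε`. -/
theorem exists_matching {ι κ : Type*} [Fintype ι] [Fintype κ] [Nonempty ι]
    {b : κ → ℝ} (hb : ∀ j, 0 ≤ b j) (hb1 : ∑ j, b j = 1) {R : ι → κ → Prop} {δ ε : ℝ}
    (hδ : 0 ≤ δ) (hε : 0 < ε)
    (hall : ∀ S : Finset ι, (S.card : ℝ) / Fintype.card ι ≤
      (∑ j, open Classical in if ∃ i ∈ S, R i j then b j else 0) + δ) :
    ∃ f : ι → κ → ℝ, (∀ i j, 0 ≤ f i j) ∧ (∀ i, ∑ j, f i j = 1 / Fintype.card ι) ∧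
      (∀ j, ∑ i, f i j = b j) ∧
      ∑ i, ∑ j, (open Classical in if R i j then 0 else f i j) ≤ δ + ε := by
  classical
  obtain ⟨f, hf0, hfR, hfr, hfc, hft⟩ := exists_partial_matching hb hδ hε hall
  have hN0 : (0 : ℝ) < Fintype.card ι := by exact_mod_cast Fintype.card_pos
  set r : ι → ℝ := fun i => 1 / Fintype.card ι - ∑ j, f i j with hr
  set s : κ → ℝ := fun j => b j - ∑ i, f i j with hs
  set ρ : ℝ := 1 - ∑ i, ∑ j, f i j with hρ
  have hr0 (i) : 0 ≤ r i := sub_nonneg.2 (hfr i)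
  have hs0 (j) : 0 ≤ s j := sub_nonneg.2 (hfc j)
  have hrs : ∑ i, r i = ρ := by
    simp [hr, hρ, Finset.sum_sub_distrib, hN0.ne']
  have hss : ∑ j, s j = ρ := by
    rw [hρ, Finset.sum_comm (f := f)]
    simp [hs, Finset.sum_sub_distrib, hb1]
  have hρ0 : 0 ≤ ρ := hrs ▸ Finset.sum_nonneg fun i _ => hr0 i
  -- The row and column deficits have the same total ρ and are coupled by their normalized product.
  -- If ρ = 0, every deficit vanishes, so division by zero does no harm.
  have hri (i) : r i * ρ / ρ = r i := by
    rcases eq_or_ne ρ 0 with h | h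
    · have := (Finset.sum_eq_zero_iff_of_nonneg (fun i _ => hr0 i)).1 (hrs.trans h) i
        (Finset.mem_univ i)
      simp [this]
    · field_simp
  have hsj (j) : ρ * s j / ρ = s j := by
    rcases eq_or_ne ρ 0 with h | h
    · have := (Finset.sum_eq_zero_iff_of_nonneg (fun i _ => hs0 i)).1 (hss.trans h) j
        (Finset.mem_univ j)
      simp [this]
    · field_simp
  refine ⟨fun i j => f i j + r i * s j / ρ, fun i j => ?_, fun i => ?_, fun j => ?_, ?_⟩
  · have := hf0 i j
    have := hr0 i
    have := hs0 j
    positivity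
  · rw [Finset.sum_add_distrib, ← Finset.sum_div, ← Finset.mul_sum, hss, hri]
    simp [hr]
  · rw [Finset.sum_add_distrib, ← Finset.sum_div, ← Finset.sum_mul, hrs, hsj]
    simp [hs]
  · calc ∑ i, ∑ j, (if R i j then 0 else f i j + r i * s j / ρ)
        ≤ ∑ i, ∑ j, r i * s j / ρ := by
          gcongr with i _ j _
          split_ifs with h
          · have := hr0 i
            have := hs0 j
            positivity
          · simp [hfR i j h]
      _ = ρ := by
          simp only [← Finset.sum_div, ← Finset.mul_sum, hss, hri, hrs]
      _ ≤ δ + ε := by linarith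

/-! ### Splitting a measure along finitely many points -/

/-- The weights `φ` split the probability measure `μ` into pieces of equal mass, the piece number
`k` being close to the point `x k`. -/
structure IsSplitting {ι X : Type*} [Fintype ι] [PseudoMetricSpace X] [MeasurableSpace X]
    (μ : Measure X) (x : ι → X) (η : ℝ) (φ : ι → X → ℝ) : Prop where
  measurable (k : ι) : Measurable (φ k)
  nonneg (k : ι) (y : X) : 0 ≤ φ k y
  sum_eq_one (y : X) : ∑ k, φ k y = 1
  integral_eq (k : ι) : ∫ y, φ k y ∂μ = 1 / Fintype.card ι
  cost_le : ∑ k, ∫ y, φ k y * dist y (x k) ∂μ ≤ η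

theorem integrable_of_nonneg_of_le {Y : Type*} [MeasurableSpace Y] {μ : Measure Y}
    [IsFiniteMeasure μ] {f : Y → ℝ} (hf : Measurable f) (C : ℝ) (h0 : ∀ y, 0 ≤ f y)
    (hC : ∀ y, f y ≤ C) : Integrable f μ :=
  .of_bound hf.aestronglyMeasurable C <| .of_forall fun y => by
    rw [Real.norm_of_nonneg (h0 y)]; exact hC y

/-- Points of X are grouped into finitely many cells according to which δ-balls around the `x k`
contain them. A matching of indices with cells along membership then prescribes how the mass of each
cell is shared among the indices. Mass matched along membership moves less than δ; the rest, at most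
δ + ε, moves at most D. -/
theorem exists_isSplitting {ι X : Type*} [Fintype ι] [Nonempty ι] [MetricSpace X]
    [MeasurableSpace X] [BorelSpace X] [SecondCountableTopology X] {μ : Measure X}
    [IsProbabilityMeasure μ] {x : ι → X} {D δ ε : ℝ} (hD : ∀ y z : X, dist y z ≤ D)
    (hδ : 0 ≤ δ) (hε : 0 < ε)
    (hμ : ∀ S : Finset ι, (S.card : ℝ) / Fintype.card ι ≤
      μ.real {y | ∃ k ∈ S, dist y (x k) < δ} + δ) :
    ∃ φ, IsSplitting μ x (δ + D * (δ + ε)) φ := by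
  classical
  let _ : MeasurableSpace (Finset ι) := ⊤
  set T : X → Finset ι := fun y => Finset.univ.filter fun k => dist y (x k) < δ with hT
  have hTm : Measurable T := by
    refine measurable_to_countable' fun A => ?_
    have : T ⁻¹' {A} = ⋂ k, {y | dist y (x k) < δ ↔ k ∈ A} := by
      ext y
      simp [hT, Finset.ext_iff]
    rw [this]
    refine MeasurableSet.iInter fun k => ?_
    have hm : MeasurableSet {y | dist y (x k) < δ} :=
      measurableSet_lt (by fun_prop) measurable_const
    by_cases hk : k ∈ A
    · simpa [hk] using hm
    · convert hm.compl using 1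
      ext y
      simp [hk]
  have hD0 : 0 ≤ D := dist_nonneg.trans (hD (x (Classical.arbitrary ι)) (x (Classical.arbitrary ι)))
  have : IsProbabilityMeasure (μ.map T) := Measure.isProbabilityMeasure_map hTm.aemeasurable
  set b : Finset ι → ℝ := fun A => (μ.map T).real {A} with hb
  have hint (F : Finset ι → ℝ) : ∫ y, F (T y) ∂μ = ∑ A, b A * F A := by
    rw [← integral_map (f := F) hTm.aemeasurable (Measurable.aestronglyMeasurable (by fun_prop)),
      integral_fintype (.of_finite)]
    rfl
  have hb1 : ∑ A, b A = 1 := by simpa using (hint fun _ => 1).symm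
  -- The cells `A` meeting `S` together form the union of the δ-balls around the points of `S`, so
  -- `hμ` is the Hall condition.
  obtain ⟨f, hf0, hfr, hfc, hft⟩ := exists_matching (R := fun k A => k ∈ A) (b := b)
    (fun A => measureReal_nonneg) hb1 hδ hε fun S => by
      refine (hμ S).trans (add_le_add_left (le_of_eq ?_) _)
      have h1 := hint fun A => if ∃ k ∈ S, k ∈ A then 1 else 0
      simp only [mul_ite, mul_one, mul_zero] at h1
      refine Eq.trans ?_ (h1.trans (Finset.sum_congr rfl fun A _ => by congr))
      rw [← integral_indicator_one]
      · refine integral_congr_ae (.of_forall fun y => ?_)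
        simp [Set.indicator_apply, hT]
      · have : {y | ∃ k ∈ S, dist y (x k) < δ} = T ⁻¹' {A | ∃ k ∈ S, k ∈ A} := by
          ext y; simp [hT]
        rw [this]
        exact hTm trivial
  -- On null cells any weights would do; uniform ones make the sum equal to 1 at every point, not
  -- just almost everywhere.
  let w : ι → Finset ι → ℝ := fun k A => if b A = 0 then 1 / Fintype.card ι else f k A / b A
  have hN0 : (0 : ℝ) < Fintype.card ι := by exact_mod_cast Fintype.card_pos
  have hfb (k A) (h : b A = 0) : f k A = 0 :=
    (Finset.sum_eq_zero_iff_of_nonneg fun k _ => hf0 k A).1 ((hfc A).trans h) k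
      (Finset.mem_univ k)
  have hbw (k A) : b A * w k A = f k A := by
    by_cases h : b A = 0
    · simp [h, hfb k A h]
    · simp only [w, if_neg h]
      field_simp
  have hw0 (k A) : 0 ≤ w k A := by
    have : 0 ≤ b A := measureReal_nonneg
    have := hf0 k A
    simp only [w]
    split_ifs <;> positivity
  have hw1 (A) : ∑ k, w k A = 1 := by
    by_cases h : b A = 0
    · simp [w, h, hN0.ne']
    · simp only [w, if_neg h, ← Finset.sum_div, hfc]
      exact div_self h
  have hwle (k A) : w k A ≤ 1 :=
    hw1 A ▸ Finset.single_le_sum (fun k _ => hw0 k A) (Finset.mem_univ k)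
  have hwm (k) : Measurable fun y => w k (T y) :=
    (measurable_from_top (f := w k)).comp hTm
  refine ⟨fun k y => w k (T y), hwm, fun k y => hw0 k _, fun y => hw1 _, fun k => ?_, ?_⟩
  · rw [hint (w k)]
    simp only [hbw, hfr]
  · calc ∑ k, ∫ y, w k (T y) * dist y (x k) ∂μ
        ≤ ∑ k, ∫ y, (fun A => w k A * (δ + if k ∈ A then 0 else D)) (T y) ∂μ := by
          refine Finset.sum_le_sum fun k _ => integral_mono ?_ ?_ fun y => ?_
          · refine integrable_of_nonneg_of_le ((hwm k).mul (by fun_prop)) (1 * D)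
              (fun y => mul_nonneg (hw0 k _) dist_nonneg) fun y => ?_
            exact mul_le_mul (hwle k _) (hD _ _) dist_nonneg zero_le_one
          · refine integrable_of_nonneg_of_le (C := 1 * (δ + D))
              ((measurable_from_top
                (f := fun A => w k A * (δ + if k ∈ A then 0 else D))).comp hTm)
              (fun y => mul_nonneg (hw0 k _) (by split_ifs <;> positivity)) fun y => ?_
            refine mul_le_mul (hwle k _) (by split_ifs <;> linarith)
              (by split_ifs <;> positivity) zero_le_one
          · refine mul_le_mul_of_nonneg_left ?_ (hw0 k _)
            by_cases h : dist y (x k) < δ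
            · simp [hT, h, h.le]
            · simpa [hT, h] using (hD y (x k)).trans (by linarith)
      _ = ∑ k, ∑ A, (δ * f k A + D * if k ∈ A then 0 else f k A) := by
          refine Finset.sum_congr rfl fun k _ => ?_
          rw [hint fun A => w k A * (δ + if k ∈ A then 0 else D)]
          refine Finset.sum_congr rfl fun A _ => ?_
          simp only [← mul_assoc, hbw]
          split_ifs <;> ring
      _ = δ + D * ∑ k, ∑ A, (if k ∈ A then 0 else f k A) := by
          simp only [Finset.sum_add_distrib, ← Finset.mul_sum, hfr]
          simp [hN0.ne']
      _ ≤ δ + D * (δ + ε) := by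
          gcongr
          refine le_trans (le_of_eq ?_) hft
          exact Finset.sum_congr rfl fun k _ => Finset.sum_congr rfl fun A _ => by congr

namespace IsSplitting

variable {ι X : Type*} [Fintype ι] [PseudoMetricSpace X] [MeasurableSpace X] {μ : Measure X}
  {x : ι → X} {η : ℝ} {φ : ι → X → ℝ}

theorem le_one (h : IsSplitting μ x η φ) (k : ι) (y : X) : φ k y ≤ 1 :=
  h.sum_eq_one y ▸ Finset.single_le_sum (fun k _ => h.nonneg k y) (Finset.mem_univ k)

end IsSplitting

/-! ### Comparison with the assignment problem -/

theorem integral_comp_fst {X Y : Type*} [MeasurableSpace X] [MeasurableSpace Y]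
    {μ : Measure X} {γ : Measure (X × Y)} (h : γ.fst = μ) {f : X → ℝ} (hf : Measurable f) :
    ∫ z, f z.1 ∂γ = ∫ x, f x ∂μ := by
  rw [← h, Measure.fst, integral_map measurable_fst.aemeasurable hf.aestronglyMeasurable]

theorem integral_comp_snd {X Y : Type*} [MeasurableSpace X] [MeasurableSpace Y]
    {ν : Measure Y} {γ : Measure (X × Y)} (h : γ.snd = ν) {f : Y → ℝ} (hf : Measurable f) :
    ∫ z, f z.2 ∂γ = ∫ y, f y ∂ν := by
  rw [← h, Measure.snd, integral_map measurable_snd.aemeasurable hf.aestronglyMeasurable]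

namespace IsSplitting

variable {ι X : Type*} [Fintype ι] [PseudoMetricSpace X] [MeasurableSpace X] {μ ν : Measure X}
  {x y : ι → X} {η η' : ℝ} {φ ψ : ι → X → ℝ}

theorem comp_perm (h : IsSplitting μ x η φ) (σ : Equiv.Perm ι) :
    IsSplitting μ (x ∘ σ) η (φ ∘ σ) where
  measurable _ := h.measurable _
  nonneg _ := h.nonneg _
  sum_eq_one z := (Equiv.sum_comp σ fun k => φ k z).trans (h.sum_eq_one z)
  integral_eq _ := h.integral_eq _
  cost_le := (Equiv.sum_comp σ fun k => ∫ y, φ k y * dist y (x k) ∂μ).trans_le h.cost_le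

theorem integrable [IsFiniteMeasure μ] (h : IsSplitting μ x η φ) (k : ι) : Integrable (φ k) μ :=
  integrable_of_nonneg_of_le (h.measurable k) 1 (h.nonneg k) (h.le_one k)

theorem integrable_mul_dist [OpensMeasurableSpace X] [BoundedSpace X] [IsFiniteMeasure μ]
    (h : IsSplitting μ x η φ) (k : ι) : Integrable (fun y => φ k y * dist y (x k)) μ :=
  integrable_of_nonneg_of_le ((h.measurable k).mul (by fun_prop))
    (1 * Metric.diam (Set.univ : Set X))
    (fun y => mul_nonneg (h.nonneg k y) dist_nonneg) fun y =>
      mul_le_mul (h.le_one k y)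
        (Metric.dist_le_diam_of_mem BoundedSpace.bounded_univ trivial trivial)
        dist_nonneg zero_le_one

/-- The density, with respect to the product measure, of the plan that transports the piece number
`k` of `μ` to the piece number `k` of `ν`. -/
noncomputable def planDensity (φ ψ : ι → X → ℝ) (z : X × X) : ℝ :=
  (Fintype.card ι : ℝ) * ∑ k, φ k z.1 * ψ k z.2

theorem measurable_planDensity (h : IsSplitting μ x η φ) (h' : IsSplitting ν y η' ψ) :
    Measurable (planDensity φ ψ) :=
  (Finset.measurable_sum _ fun k _ => ((h.measurable k).comp measurable_fst).mul
    ((h'.measurable k).comp measurable_snd)).const_mul _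

theorem planDensity_nonneg (h : IsSplitting μ x η φ) (h' : IsSplitting ν y η' ψ) (z : X × X) :
    0 ≤ planDensity φ ψ z :=
  mul_nonneg (Nat.cast_nonneg _)
    (Finset.sum_nonneg fun k _ => mul_nonneg (h.nonneg k _) (h'.nonneg k _))

theorem integrable_planDensity [IsFiniteMeasure μ] [IsFiniteMeasure ν]
    (h : IsSplitting μ x η φ) (h' : IsSplitting ν y η' ψ) :
    Integrable (planDensity φ ψ) (μ.prod ν) :=
  (integrable_finsetSum _ fun k _ => (h.integrable k).mul_prod (h'.integrable k)).const_mul _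

/-- The plan that transports the piece number `k` of `μ` to the piece number `k` of `ν`. -/
noncomputable def plan (μ ν : Measure X) (φ ψ : ι → X → ℝ) : Measure (X × X) :=
  (μ.prod ν).withDensity fun z => ENNReal.ofReal (planDensity φ ψ z)

/-- Used with one side the whole space: the factor N then cancels the mass 1/N of each piece, which
gives both marginals. -/
theorem plan_apply [IsFiniteMeasure μ] [IsFiniteMeasure ν]
    (h : IsSplitting μ x η φ) (h' : IsSplitting ν y η' ψ) {A B : Set X} (hA : MeasurableSet A)
    (hB : MeasurableSet B) :
    plan μ ν φ ψ (A ×ˢ B) = ENNReal.ofReal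
      (Fintype.card ι * ∑ k, (∫ x in A, φ k x ∂μ) * ∫ y in B, ψ k y ∂ν) := by
  rw [plan, withDensity_apply _ (hA.prod hB), ← ofReal_integral_eq_lintegral_ofReal
    (h.integrable_planDensity h').integrableOn (.of_forall (h.planDensity_nonneg h'))]
  simp only [planDensity]
  rw [integral_const_mul, integral_finsetSum _ fun k _ =>
    ((h.integrable k).mul_prod (h'.integrable k)).integrableOn]
  simp only [setIntegral_prod_mul]

theorem sum_setIntegral [IsFiniteMeasure μ] (h : IsSplitting μ x η φ) (A : Set X) :
    ∑ k, ∫ x in A, φ k x ∂μ = μ.real A := by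
  rw [← integral_finsetSum _ fun k _ => (h.integrable k).integrableOn]
  simp [h.sum_eq_one]

theorem fst_plan [Nonempty ι] [IsFiniteMeasure μ] [IsFiniteMeasure ν]
    (h : IsSplitting μ x η φ) (h' : IsSplitting ν y η' ψ) : (plan μ ν φ ψ).fst = μ := by
  ext A hA
  have hN : (Fintype.card ι : ℝ) ≠ 0 := by exact_mod_cast Fintype.card_ne_zero
  rw [Measure.fst_apply hA, ← Set.prod_univ, h.plan_apply h' hA .univ]
  simp only [setIntegral_univ, h'.integral_eq, ← Finset.sum_mul, h.sum_setIntegral]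
  rw [mul_left_comm, mul_one_div_cancel hN, mul_one, measureReal_def,
    ENNReal.ofReal_toReal (measure_ne_top _ _)]

theorem snd_plan [Nonempty ι] [IsFiniteMeasure μ] [IsFiniteMeasure ν]
    (h : IsSplitting μ x η φ) (h' : IsSplitting ν y η' ψ) : (plan μ ν φ ψ).snd = ν := by
  ext A hA
  have hN : (Fintype.card ι : ℝ) ≠ 0 := by exact_mod_cast Fintype.card_ne_zero
  rw [Measure.snd_apply hA, ← Set.univ_prod, h.plan_apply h' .univ hA]
  simp only [setIntegral_univ, h.integral_eq, ← Finset.mul_sum, h'.sum_setIntegral]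
  rw [← mul_assoc, mul_one_div_cancel hN, one_mul, measureReal_def,
    ENNReal.ofReal_toReal (measure_ne_top _ _)]

theorem integrable_mul_plan {γ : Measure (X × X)} [IsFiniteMeasure γ] (h : IsSplitting μ x η φ)
    (h' : IsSplitting ν y η' ψ) (k l : ι) :
    Integrable (fun z : X × X => φ k z.1 * ψ l z.2) γ :=
  integrable_of_nonneg_of_le (((h.measurable k).comp measurable_fst).mul
    ((h'.measurable l).comp measurable_snd)) (1 * 1)
    (fun _ => mul_nonneg (h.nonneg k _) (h'.nonneg l _)) fun _ =>
      mul_le_mul (h.le_one k _) (h'.le_one l _) (h'.nonneg l _) zero_le_one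

/-- The doubly stochastic matrix of the masses that a plan transports from the pieces of one measure
to the pieces of another. -/
noncomputable def transportMatrix (γ : Measure (X × X)) (φ ψ : ι → X → ℝ) : Matrix ι ι ℝ :=
  fun k l => Fintype.card ι * ∫ z, φ k z.1 * ψ l z.2 ∂γ

/-- Summing over one index removes its weights, since they form a partition of unity. What remains
is N times the mass 1/N of a single piece. -/
theorem transportMatrix_mem [DecidableEq ι] [Nonempty ι] {γ : Measure (X × X)}
    [IsProbabilityMeasure γ] (h : IsSplitting μ x η φ)
    (h' : IsSplitting ν y η' ψ) (hfst : γ.fst = μ) (hsnd : γ.snd = ν) :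
    transportMatrix γ φ ψ ∈ doublyStochastic ℝ ι := by
  have hN : (Fintype.card ι : ℝ) ≠ 0 := by exact_mod_cast Fintype.card_ne_zero
  refine mem_doublyStochastic_iff_sum.2 ⟨fun k l => ?_, fun k => ?_, fun l => ?_⟩
  · exact mul_nonneg (Nat.cast_nonneg _)
      (integral_nonneg fun z => mul_nonneg (h.nonneg k _) (h'.nonneg l _))
  · simp only [transportMatrix]
    rw [← Finset.mul_sum, ← integral_finsetSum _ fun l _ => h.integrable_mul_plan h' k l]
    simp only [← Finset.mul_sum, h'.sum_eq_one, mul_one]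
    rw [integral_comp_fst hfst (h.measurable k), h.integral_eq, mul_one_div_cancel hN]
  · simp only [transportMatrix]
    rw [← Finset.mul_sum, ← integral_finsetSum _ fun k _ => h.integrable_mul_plan h' k l]
    simp only [← Finset.sum_mul, h.sum_eq_one, one_mul]
    rw [integral_comp_snd hsnd (h'.measurable l), h'.integral_eq, mul_one_div_cancel hN]

section cost

variable [OpensMeasurableSpace X] [BoundedSpace X] [Nonempty ι]
  [IsProbabilityMeasure μ] [IsProbabilityMeasure ν] {c : X → X → ℝ} {B L : ℝ}

/-- On the product of the k-th pieces, c is replaced by its value at (`x k`, `y k`). The Lipschitz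
error integrates to the costs of the two splittings. -/
theorem integral_plan_le (h : IsSplitting μ x η φ) (h' : IsSplitting ν y η' ψ)
    (hcm : Measurable fun z : X × X => c z.1 z.2) (hc0 : ∀ u v, 0 ≤ c u v)
    (hcB : ∀ u v, c u v ≤ B) (hL : 0 ≤ L)
    (hcL : ∀ u v u' v', |c u v - c u' v'| ≤ L * (dist u u' + dist v v')) :
    ∫ z, c z.1 z.2 ∂(plan μ ν φ ψ) ≤
      (∑ k, c (x k) (y k)) / Fintype.card ι + L * (η + η') := by
  set N := (Fintype.card ι : ℝ) with hN
  have hN0 : 0 < N := by rw [hN]; exact_mod_cast Fintype.card_pos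
  have hB0 : 0 ≤ B := (hc0 (x (Classical.arbitrary ι)) (x (Classical.arbitrary ι))).trans (hcB _ _)
  rw [plan, integral_withDensity_eq_integral_toReal_smul
    (h.measurable_planDensity h').ennreal_ofReal (by simp)]
  simp only [ENNReal.toReal_ofReal (h.planDensity_nonneg h' _), smul_eq_mul]
  have hi1 (k) := (h.integrable k).mul_prod (h'.integrable k)
  have hi2 (k) := (h.integrable_mul_dist k).mul_prod (h'.integrable k)
  have hi3 (k) := (h.integrable k).mul_prod (h'.integrable_mul_dist k)
  have hi4 (k) : Integrable (fun z : X × X => L * (φ k z.1 * dist z.1 (x k) * ψ k z.2 +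
      φ k z.1 * (ψ k z.2 * dist z.2 (y k)))) (μ.prod ν) := ((hi2 k).add (hi3 k)).const_mul L
  have hi (k) : Integrable (fun z : X × X => N * (c (x k) (y k) * (φ k z.1 * ψ k z.2) +
      L * (φ k z.1 * dist z.1 (x k) * ψ k z.2 + φ k z.1 * (ψ k z.2 * dist z.2 (y k)))))
      (μ.prod ν) := (((hi1 k).const_mul (c (x k) (y k))).add (hi4 k)).const_mul N
  calc ∫ z, planDensity φ ψ z * c z.1 z.2 ∂(μ.prod ν)
      ≤ ∫ z, ∑ k, N * (c (x k) (y k) * (φ k z.1 * ψ k z.2) +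
          L * (φ k z.1 * dist z.1 (x k) * ψ k z.2 +
            φ k z.1 * (ψ k z.2 * dist z.2 (y k)))) ∂(μ.prod ν) := by
        refine integral_mono ?_ (integrable_finsetSum _ fun k _ => hi k) fun z => ?_
        · refine Integrable.mul_bdd (c := B) (h.integrable_planDensity h') hcm.aestronglyMeasurable
            (.of_forall fun z => ?_)
          rw [Real.norm_of_nonneg (hc0 _ _)]
          exact hcB _ _
        · simp only [planDensity]
          rw [mul_assoc, Finset.sum_mul, Finset.mul_sum]
          refine Finset.sum_le_sum fun k _ => mul_le_mul_of_nonneg_left ?_ hN0.le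
          have h1 := (abs_le.1 (hcL z.1 z.2 (x k) (y k))).2
          have h2 := mul_nonneg (h.nonneg k z.1) (h'.nonneg k z.2)
          calc φ k z.1 * ψ k z.2 * c z.1 z.2 ≤ φ k z.1 * ψ k z.2 *
                (c (x k) (y k) + L * (dist z.1 (x k) + dist z.2 (y k))) := by
                gcongr; linarith
            _ = _ := by ring
    _ = ∑ k, N * (c (x k) (y k) * (1 / N * (1 / N)) +
          L * ((∫ u, φ k u * dist u (x k) ∂μ) * (1 / N) +
            1 / N * ∫ u, ψ k u * dist u (y k) ∂ν)) := by
        rw [integral_finsetSum _ fun k _ => hi k]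
        refine Finset.sum_congr rfl fun k _ => ?_
        rw [integral_const_mul, integral_add ((hi1 k).const_mul _) (hi4 k), integral_const_mul, integral_const_mul,
          integral_add (hi2 k) (hi3 k), integral_prod_mul (φ k) (ψ k),
          integral_prod_mul (fun u => φ k u * dist u (x k)) (ψ k),
          integral_prod_mul (φ k) fun u => ψ k u * dist u (y k), h.integral_eq, h'.integral_eq]
    _ = (∑ k, c (x k) (y k)) / N + L * (∑ k, ∫ u, φ k u * dist u (x k) ∂μ +
          ∑ k, ∫ u, ψ k u * dist u (y k) ∂ν) := by
        rw [← Finset.sum_add_distrib, Finset.mul_sum, Finset.sum_div, ← Finset.sum_add_distrib]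
        refine Finset.sum_congr rfl fun k _ => ?_
        field_simp
    _ ≤ _ := by
        gcongr
        exacts [h.cost_le, h'.cost_le]

variable {γ : Measure (X × X)} [IsProbabilityMeasure γ]

/-- The Lipschitz comparison in the other direction, valid for any plan: the products φ k * ψ l form
a partition of unity on X × X, so averaging c(z) over them gives back c(z). -/
theorem sum_transportMatrix_le (h : IsSplitting μ x η φ)
    (h' : IsSplitting ν y η' ψ) (hfst : γ.fst = μ) (hsnd : γ.snd = ν)
    (hcm : Measurable fun z : X × X => c z.1 z.2) (hc0 : ∀ u v, 0 ≤ c u v)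
    (hcB : ∀ u v, c u v ≤ B) (hL : 0 ≤ L)
    (hcL : ∀ u v u' v', |c u v - c u' v'| ≤ L * (dist u u' + dist v v')) :
    (∑ k, ∑ l, transportMatrix γ φ ψ k l * c (x k) (y l)) / Fintype.card ι ≤
      ∫ z, c z.1 z.2 ∂γ + L * (η + η') := by
  have hN : (Fintype.card ι : ℝ) ≠ 0 := by exact_mod_cast Fintype.card_ne_zero
  have hic : Integrable (fun z : X × X => c z.1 z.2) γ :=
    integrable_of_nonneg_of_le hcm B (fun _ => hc0 _ _) fun _ => hcB _ _
  have hi1 (k) : Integrable (fun z : X × X => φ k z.1 * dist z.1 (x k)) γ := by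
    have := h.integrable_mul_dist k
    rw [← hfst] at this
    exact this.comp_measurable measurable_fst
  have hi2 (k) : Integrable (fun z : X × X => ψ k z.2 * dist z.2 (y k)) γ := by
    have := h'.integrable_mul_dist k
    rw [← hsnd] at this
    exact this.comp_measurable measurable_snd
  have hi3 := integrable_finsetSum Finset.univ fun k _ => hi1 k
  have hi4 := integrable_finsetSum Finset.univ fun k _ => hi2 k
  have hi6 : Integrable (fun z : X × X => L * (∑ k, φ k z.1 * dist z.1 (x k) +
      ∑ l, ψ l z.2 * dist z.2 (y l))) γ := (hi3.add hi4).const_mul L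
  have hi5 (k l) := (h.integrable_mul_plan (γ := γ) h' k l).mul_const (c (x k) (y l))
  calc (∑ k, ∑ l, transportMatrix γ φ ψ k l * c (x k) (y l)) / Fintype.card ι
      = ∫ z, ∑ k, ∑ l, φ k z.1 * ψ l z.2 * c (x k) (y l) ∂γ := by
        rw [integral_finsetSum _ fun k _ => integrable_finsetSum _ fun l _ => hi5 k l,
          Finset.sum_div]
        refine Finset.sum_congr rfl fun k _ => ?_
        rw [integral_finsetSum _ fun l _ => hi5 k l, Finset.sum_div]
        refine Finset.sum_congr rfl fun l _ => ?_
        rw [integral_mul_const, transportMatrix]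
        field_simp
    _ ≤ ∫ z, (c z.1 z.2 + L * (∑ k, φ k z.1 * dist z.1 (x k) +
          ∑ l, ψ l z.2 * dist z.2 (y l))) ∂γ := by
        refine integral_mono
          (integrable_finsetSum _ fun k _ => integrable_finsetSum _ fun l _ => hi5 k l)
          (hic.add hi6) fun z => ?_
        calc ∑ k, ∑ l, φ k z.1 * ψ l z.2 * c (x k) (y l)
            ≤ ∑ k, ∑ l, φ k z.1 * ψ l z.2 *
                (c z.1 z.2 + L * (dist z.1 (x k) + dist z.2 (y l))) := by
              refine Finset.sum_le_sum fun k _ => Finset.sum_le_sum fun l _ =>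
                mul_le_mul_of_nonneg_left ?_ (mul_nonneg (h.nonneg k _) (h'.nonneg l _))
              have h1 := (abs_le.1 (hcL z.1 z.2 (x k) (y l))).1
              linarith
          _ = ∑ k, ∑ l, (φ k z.1 * c z.1 z.2 * ψ l z.2 +
                L * (φ k z.1 * dist z.1 (x k)) * ψ l z.2 +
                φ k z.1 * (L * (ψ l z.2 * dist z.2 (y l)))) :=
              Finset.sum_congr rfl fun k _ => Finset.sum_congr rfl fun l _ => by ring
          _ = _ := by
              simp only [Finset.sum_add_distrib, ← Finset.mul_sum, h'.sum_eq_one, mul_one,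
                ← Finset.sum_mul, h.sum_eq_one, one_mul]
              ring
    _ = ∫ z, c z.1 z.2 ∂γ + L * (∑ k, ∫ u, φ k u * dist u (x k) ∂μ +
          ∑ l, ∫ u, ψ l u * dist u (y l) ∂ν) := by
        rw [integral_add hic hi6, integral_const_mul,
          integral_add hi3 hi4, integral_finsetSum _ fun k _ => hi1 k,
          integral_finsetSum _ fun k _ => hi2 k]
        congr 3
        · exact Finset.sum_congr rfl fun k _ => integral_comp_fst hfst
            (f := fun u => φ k u * dist u (x k)) ((h.measurable k).mul (by fun_prop))
        · exact Finset.sum_congr rfl fun k _ => integral_comp_snd hsnd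
            (f := fun u => ψ k u * dist u (y k)) ((h'.measurable k).mul (by fun_prop))
    _ ≤ _ := by
        gcongr
        exacts [h.cost_le, h'.cost_le]

end cost

end IsSplitting

/-- The minimum of a linear functional on doubly stochastic matrices is attained at a permutation. -/
theorem le_sum_mul_of_mem_doublyStochastic {ι : Type*} [Fintype ι] [DecidableEq ι]
    {M : Matrix ι ι ℝ} (hM : M ∈ doublyStochastic ℝ ι) {a : ι → ι → ℝ} {V : ℝ}
    (hV : ∀ σ : Equiv.Perm ι, V ≤ ∑ k, a k (σ k)) : V ≤ ∑ k, ∑ l, M k l * a k l := by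
  obtain ⟨w, hw0, hw1, rfl⟩ := exists_eq_sum_perm_of_mem_doublyStochastic hM
  calc V = ∑ σ, w σ * V := by rw [← Finset.sum_mul, hw1, one_mul]
    _ ≤ ∑ σ, w σ * ∑ k, a k (σ k) :=
        Finset.sum_le_sum fun σ _ => mul_le_mul_of_nonneg_left (hV σ) (hw0 σ)
    _ = _ := by
        simp only [Matrix.sum_apply, Finset.sum_mul, Matrix.smul_apply, smul_eq_mul,
          Finset.mul_sum]
        rw [Finset.sum_comm]
        refine Finset.sum_congr rfl fun k _ => ?_
        rw [Finset.sum_comm]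
        refine Finset.sum_congr rfl fun σ _ => ?_
        simp [Equiv.Perm.permMatrix, PEquiv.toMatrix_apply, Equiv.toPEquiv_apply]

/-- The optimal cost between two measures that are split along the points `x k` and `y k` is close
to the optimal value of the corresponding assignment problem. -/
theorem abs_optimalCost_sub_le {ι X : Type*} [Fintype ι] [Nonempty ι] [PseudoMetricSpace X]
    [MeasurableSpace X] [OpensMeasurableSpace X] [BoundedSpace X] {μ ν : ProbabilityMeasure X}
    {x y : ι → X} {η η' : ℝ} {φ ψ : ι → X → ℝ} (h : IsSplitting (μ : Measure X) x η φ)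
    (h' : IsSplitting (ν : Measure X) y η' ψ) {c : X → X → ℝ} {B L V : ℝ}
    (hcm : Measurable fun z : X × X => c z.1 z.2) (hc0 : ∀ u v, 0 ≤ c u v)
    (hcB : ∀ u v, c u v ≤ B) (hL : 0 ≤ L)
    (hcL : ∀ u v u' v', |c u v - c u' v'| ≤ L * (dist u u' + dist v v'))
    (hV : IsLeast (Set.range fun σ : Equiv.Perm ι => ∑ k, c (x k) (y (σ k))) V) :
    |optimalCost c μ ν - V / Fintype.card ι| ≤ L * (η + η') := by
  classical
  obtain ⟨⟨σ, hσ⟩, hVle⟩ := hV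
  have hbdd : BddBelow ((fun γ : ProbabilityMeasure (X × X) =>
      ∫ z, c z.1 z.2 ∂(γ : Measure (X × X))) '' transferencePlans μ ν) := by
    refine ⟨0, ?_⟩
    rintro _ ⟨γ, _, rfl⟩
    exact integral_nonneg fun z => hc0 _ _
  -- Relabelling the pieces of ν by the optimal σ makes the assignment diagonal, the form that
  -- `plan` realizes.
  have hs := h'.comp_perm σ
  let γ := IsSplitting.plan (μ : Measure X) ν φ (ψ ∘ σ)
  have hγ : IsProbabilityMeasure γ := ⟨by
    rw [← Measure.fst_univ, h.fst_plan hs, measure_univ]⟩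
  have hmem : (⟨γ, hγ⟩ : ProbabilityMeasure (X × X)) ∈ transferencePlans μ ν :=
    ⟨h.fst_plan hs, h.snd_plan hs⟩
  rw [abs_le]
  constructor
  · rw [neg_le_sub_iff_le_add, ← sub_le_iff_le_add]
    refine le_csInf ⟨_, _, hmem, rfl⟩ ?_
    rintro _ ⟨γ', hγ', rfl⟩
    rw [sub_le_iff_le_add]
    refine le_trans ?_ (h.sum_transportMatrix_le h' hγ'.1 hγ'.2 hcm hc0 hcB hL hcL)
    gcongr
    exact le_sum_mul_of_mem_doublyStochastic (h.transportMatrix_mem h' hγ'.1 hγ'.2)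
      (a := fun k l => c (x k) (y l)) fun σ => hVle ⟨σ, rfl⟩
  · rw [sub_le_iff_le_add']
    refine (csInf_le hbdd ⟨_, hmem, rfl⟩).trans ?_
    refine (h.integral_plan_le hs hcm hc0 hcB hL hcL).trans_eq ?_
    simp [← hσ]

/-! ### Ideal measures as uniform measures -/

/-- The uniform probability measure on a finite family of points. -/
noncomputable def uniformMeasure {ι X : Type*} [Fintype ι] [MeasurableSpace X] (x : ι → X) :
    Measure X :=
  (Fintype.card ι : ENNReal)⁻¹ • ∑ k, Measure.dirac (x k)

section uniformMeasure

variable {ι κ X : Type*} [Fintype ι] [Fintype κ] [MeasurableSpace X]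

theorem uniformMeasure_comp_equiv (x : ι → X) (e : κ ≃ ι) :
    uniformMeasure (fun k => x (e k)) = uniformMeasure x := by
  rw [uniformMeasure, uniformMeasure, Fintype.card_congr e,
    e.sum_comp fun k => Measure.dirac (x k)]

theorem uniformMeasure_comp_fst [Nonempty κ] (x : ι → X) :
    uniformMeasure (fun k : ι × κ => x k.1) = uniformMeasure x := by
  have h : (Fintype.card κ : ENNReal) ≠ 0 := by exact_mod_cast Fintype.card_ne_zero
  rw [uniformMeasure, uniformMeasure, Fintype.sum_prod_type]
  simp only [Finset.sum_const, Finset.card_univ, Fintype.card_prod, Nat.cast_mul]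
  rw [← Finset.smul_sum, ← Nat.cast_smul_eq_nsmul ENNReal, smul_smul,
    ENNReal.mul_inv (.inr (by simp)) (.inr h), mul_assoc, ENNReal.inv_mul_cancel h (by simp),
    mul_one]

theorem uniformMeasure_comp_snd [Nonempty κ] (x : ι → X) :
    uniformMeasure (fun k : κ × ι => x k.2) = uniformMeasure x := by
  rw [← uniformMeasure_comp_fst (κ := κ) x,
    ← uniformMeasure_comp_equiv (fun k : ι × κ => x k.1) (Equiv.prodComm κ ι)]
  rfl

instance [Nonempty ι] (x : ι → X) : IsProbabilityMeasure (uniformMeasure x) := ⟨by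
  simp only [uniformMeasure, Measure.smul_apply, Measure.finsetSum_apply, measure_univ]
  simpa using ENNReal.inv_mul_cancel (a := Fintype.card ι) (by simp) (by simp)⟩

theorem card_div_le_uniformMeasure (x : ι → X) {S : Finset ι} {A : Set X}
    (hA : MeasurableSet A) (hS : ∀ k ∈ S, x k ∈ A) :
    (S.card : ℝ) / Fintype.card ι ≤ (uniformMeasure x).real A := by
  classical
  rw [uniformMeasure, measureReal_ennreal_smul_apply, div_eq_inv_mul]
  simp only [ENNReal.toReal_inv, ENNReal.toReal_natCast]
  gcongr
  rw [measureReal_def, Measure.finsetSum_apply]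
  have h : ((S.card : ℕ) : ENNReal) ≤ ∑ k, Measure.dirac (x k) A := by
    calc ((S.card : ℕ) : ENNReal) = ∑ k ∈ S, Measure.dirac (x k) A := by
          rw [Finset.sum_congr rfl fun k hk => by
            rw [Measure.dirac_apply' _ hA, Set.indicator_of_mem (hS k hk)]]
          simp
      _ ≤ _ := Finset.sum_le_sum_of_subset (Finset.subset_univ S)
  simpa using ENNReal.toReal_mono (by
    exact ENNReal.sum_ne_top.2 fun k _ => measure_ne_top _ _) h

end uniformMeasure

theorem measureReal_le_of_levyProkhorovDist_lt {X : Type*} [PseudoMetricSpace X]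
    [MeasurableSpace X] {μ ν : Measure X} [IsFiniteMeasure μ] [IsFiniteMeasure ν] {δ : ℝ}
    (h : levyProkhorovDist μ ν < δ) {A : Set X} (hA : MeasurableSet A) :
    μ.real A ≤ ν.real (Metric.thickening δ A) + δ := by
  have hδ : 0 ≤ δ := ENNReal.toReal_nonneg.trans h.le
  have h' : levyProkhorovEDist μ ν < ENNReal.ofReal δ :=
    (ENNReal.lt_ofReal_iff_toReal_lt (levyProkhorovEDist_ne_top μ ν)).2 h
  have h1 := left_measure_le_of_levyProkhorovEDist_lt h' hA
  rw [ENNReal.toReal_ofReal hδ] at h1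
  have h2 := ENNReal.toReal_mono (by finiteness) h1
  rwa [ENNReal.toReal_add (by finiteness) (by finiteness), ENNReal.toReal_ofReal hδ] at h2

/-- The Hall condition for `S` is the Prokhorov inequality for the finite set `x '' S`, whose
δ-thickening is the union of the δ-balls around its points. The constant comes from δ + D * (δ + δ)
≤ 3 * D * δ, as D ≥ 1. -/
theorem exists_isSplitting_of_levyProkhorovDist_lt {ι X : Type*} [Fintype ι] [Nonempty ι]
    [MetricSpace X] [MeasurableSpace X] [BorelSpace X] [SecondCountableTopology X]
    {μ : Measure X} [IsProbabilityMeasure μ] {x : ι → X} {D δ : ℝ}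
    (hD : ∀ y z : X, dist y z ≤ D) (hD1 : 1 ≤ D)
    (h : levyProkhorovDist (uniformMeasure x) μ < δ) :
    ∃ φ, IsSplitting μ x (3 * D * δ) φ := by
  have hδ : 0 < δ := lt_of_le_of_lt ENNReal.toReal_nonneg h
  obtain ⟨φ, hφ⟩ := exists_isSplitting (μ := μ) (x := x) hD hδ.le hδ fun S => by
    have hm : MeasurableSet (x '' S) := (S.finite_toSet.image x).measurableSet
    refine (card_div_le_uniformMeasure x hm fun k hk => Set.mem_image_of_mem x hk).trans
      ((measureReal_le_of_levyProkhorovDist_lt h hm).trans_eq ?_)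
    congr 2
    ext y
    simp [Metric.mem_thickening_iff]
  exact ⟨φ, { hφ with cost_le := hφ.cost_le.trans (by nlinarith) }⟩

/-- The list of the indices `i` of the entries `(w, i)` of a list, each repeated `w + 1` times. -/
def expand (l : List (ℕ × ℕ)) : List ℕ :=
  l.flatMap fun e => List.replicate (e.1 + 1) e.2

theorem length_expand (l : List (ℕ × ℕ)) : (expand l).length = totalWeight l := by
  simp [expand, totalWeight, List.length_flatMap]

/-- The list of the indices of the special points on which an ideal measure is concentrated, with
multiplicities. -/
def indexList (n : ℕ) : List ℕ :=
  let t := Denumerable.ofNat ((ℕ × ℕ) × List (ℕ × ℕ)) n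
  expand (t.1 :: t.2)

theorem length_indexList_pos (n : ℕ) : 0 < (indexList n).length := by
  simp [indexList, expand]

/-- The number of atoms in a common refinement of the index lists of two ideal measures. -/
def atomCount (b c : ℕ) : ℕ := (indexList b).length * (indexList c).length

theorem atomCount_pos (b c : ℕ) : 0 < atomCount b c :=
  Nat.mul_pos (length_indexList_pos b) (length_indexList_pos c)

/-- The index of the atom number `k < atomCount b c` of the ideal measure number `b`. -/
def sourceIndex (b c k : ℕ) : ℕ := (indexList b).getD (k / (indexList c).length) 0

/-- The index of the atom number `k < atomCount b c` of the ideal measure number `c`. -/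
def targetIndex (c k : ℕ) : ℕ := (indexList c).getD (k % (indexList c).length) 0

section Measures

variable {X : Type*} [MeasurableSpace X]

theorem weightedSum_eq (α : ℕ → X) (l : List (ℕ × ℕ)) :
    weightedSum α l = ((expand l).map fun i => Measure.dirac (α i)).sum := by
  induction l with
  | nil => simp [weightedSum, expand]
  | cons e l ih =>
    simp only [weightedSum, expand, List.map_cons, List.sum_cons, List.flatMap_cons,
      List.map_append, List.sum_append, List.map_replicate, List.sum_replicate] at ih ⊢
    rw [ih, Nat.cast_smul_eq_nsmul]

theorem idealMeasure_eq (α : ℕ → X) (n : ℕ) :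
    idealMeasure α n =
      uniformMeasure fun k : Fin (indexList n).length => α ((indexList n).getD k 0) := by
  rw [uniformMeasure, Fintype.card_fin, idealMeasure, weightedSum_eq, ← length_expand]
  change ((indexList n).length : ENNReal)⁻¹ •
    ((indexList n).map fun i => Measure.dirac (α i)).sum = _
  congr 1
  rw [← Fin.sum_univ_fun_getElem]
  simp

/-- Quotient and remainder by the length of the second list are the coordinates of
`finProdFinEquiv.symm`. Repeating every atom equally often does not change a uniform measure, so
both ideal measures become uniform over the same index type. -/
theorem idealMeasure_eq_source (α : ℕ → X) (b c : ℕ) :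
    idealMeasure α b = uniformMeasure fun k : Fin (atomCount b c) => α (sourceIndex b c k) := by
  have := Fin.pos_iff_nonempty.1 (length_indexList_pos c)
  rw [idealMeasure_eq, ← uniformMeasure_comp_fst (κ := Fin (indexList c).length),
    ← uniformMeasure_comp_equiv _ finProdFinEquiv.symm]
  rfl

theorem idealMeasure_eq_target (α : ℕ → X) (b c : ℕ) :
    idealMeasure α c = uniformMeasure fun k : Fin (atomCount b c) => α (targetIndex c k) := by
  have := Fin.pos_iff_nonempty.1 (length_indexList_pos b)
  rw [idealMeasure_eq, ← uniformMeasure_comp_snd (κ := Fin (indexList b).length),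
    ← uniformMeasure_comp_equiv _ finProdFinEquiv.symm]
  rfl

end Measures

/-! ### Computing the optimal value of an assignment problem -/

theorem computable_sum_range {β : Type*} [Primcodable β] {f : β → ℕ → ℕ} {N : β → ℕ}
    (hf : Computable₂ f) (hN : Computable N) :
    Computable fun a => ∑ k ∈ Finset.range (N a), f a k := by
  have hs : Computable₂ fun (a : β) (s : ℕ × ℕ) => s.2 + f a s.1 :=
    (Primrec.nat_add.to_comp).comp (Computable.snd.comp Computable.snd)
      (hf.comp Computable.fst (Computable.fst.comp Computable.snd))
  refine (Computable.nat_rec hN (Computable.const 0) hs).of_eq fun a => ?_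
  induction N a with
  | zero => rfl
  | succ n ih => rw [Finset.sum_range_succ, ← ih]

/-- The least of the values `f 0, …, f n`. -/
def minUpTo (f : ℕ → ℕ) (n : ℕ) : ℕ :=
  Nat.rec (f 0) (fun k m => min m (f (k + 1))) n

theorem isLeast_minUpTo (f : ℕ → ℕ) (n : ℕ) : IsLeast (f '' Set.Iic n) (minUpTo f n) := by
  induction n with
  | zero =>
    have : Set.Iic 0 = {0} := by ext; simp
    simp [this, minUpTo]
  | succ n ih =>
    have : Set.Iic (n + 1) = insert (n + 1) (Set.Iic n) := by ext; simp; omega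
    rw [this, Set.image_insert_eq]
    have := ih.insert (f (n + 1))
    rwa [min_comm] at this

theorem computable_minUpTo {β : Type*} [Primcodable β] {f : β → ℕ → ℕ} {N : β → ℕ}
    (hf : Computable₂ f) (hN : Computable N) : Computable fun a => minUpTo (f a) (N a) := by
  have hs : Computable₂ fun (a : β) (s : ℕ × ℕ) => min s.2 (f a (s.1 + 1)) :=
    (Primrec.nat_min.to_comp).comp (Computable.snd.comp Computable.snd)
      (hf.comp Computable.fst (Computable.succ.comp (Computable.fst.comp Computable.snd)))
  exact Computable.nat_rec hN (hf.comp Computable.id (Computable.const 0)) hs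

/-- The digit number `k` of `t` in base `N`. -/
def digit (N t k : ℕ) : ℕ := t / N ^ k % N

/-- The cost of the map from `{0, …, N - 1}` to itself that is given by the digits of `t`, with a
penalty for every collision. -/
def assignmentCost (c : ℕ → ℕ → ℕ) (N t : ℕ) : ℕ :=
  ∑ k ∈ Finset.range N, c k (digit N t k) +
    (∑ k ∈ Finset.range N, ∑ l ∈ Finset.range N, c k l) *
      ∑ k ∈ Finset.range N, ∑ j ∈ Finset.range k, if digit N t k = digit N t j then 1 else 0

/-- The optimal value of the assignment problem with the cost matrix `c` of size `N`. -/
def assignmentMin (c : ℕ → ℕ → ℕ) (N : ℕ) : ℕ :=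
  minUpTo (assignmentCost c N) (N ^ N)

/-- Base-N digits code all self-maps of {0, …, N - 1}. One collision already costs the sum of all
matrix entries, which is at least the cost of the identity, so non-injective maps cannot lower the
minimum. The extra code N ^ N is harmless, since its digits also define a self-map. -/
theorem isLeast_assignmentMin (c : ℕ → ℕ → ℕ) {N : ℕ} (hN : 0 < N) :
    IsLeast (Set.range fun σ : Equiv.Perm (Fin N) => ∑ k : Fin N, c k (σ k)) (assignmentMin c N) := by
  have hmin := isLeast_minUpTo (assignmentCost c N) (N ^ N)
  have hperm (σ : Equiv.Perm (Fin N)) : ∃ t ≤ N ^ N, assignmentCost c N t = ∑ k : Fin N, c k (σ k) := by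
    refine ⟨finFunctionFinEquiv σ, (Fin.isLt _).le, ?_⟩
    have hd (k : Fin N) : digit N (finFunctionFinEquiv σ) k = σ k := by
      have := congrArg Fin.val
        (congrFun (finFunctionFinEquiv.symm_apply_apply (σ : Fin N → Fin N)) k)
      rwa [finFunctionFinEquiv_symm_apply_val] at this
    have hc : ∑ k ∈ Finset.range N, ∑ j ∈ Finset.range k,
        (if digit N (finFunctionFinEquiv σ) k = digit N (finFunctionFinEquiv σ) j
          then 1 else 0) = 0 := by
      refine Finset.sum_eq_zero fun k hk => Finset.sum_eq_zero fun j hj => if_neg fun h => ?_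
      have hk' := Finset.mem_range.1 hk
      have hj' := Finset.mem_range.1 hj
      rw [hd ⟨k, hk'⟩, hd ⟨j, hj'.trans hk'⟩] at h
      have := σ.injective (Fin.ext h)
      simp only [Fin.mk.injEq] at this
      omega
    rw [assignmentCost, hc, mul_zero, add_zero, Finset.sum_range]
    simp only [hd]
  have hle (σ : Equiv.Perm (Fin N)) : assignmentMin c N ≤ ∑ k : Fin N, c k (σ k) := by
    obtain ⟨t, ht, h⟩ := hperm σ
    exact h ▸ hmin.2 ⟨t, ht, rfl⟩
  refine ⟨?_, by rintro _ ⟨σ, rfl⟩; exact hle σ⟩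
  obtain ⟨t, -, ht⟩ := hmin.1
  change assignmentCost c N t = assignmentMin c N at ht
  let s : Fin N → Fin N := fun k => ⟨digit N t k, Nat.mod_lt _ hN⟩
  by_cases hs : Function.Injective s
  · let σ := Equiv.ofBijective s (Finite.injective_iff_bijective.1 hs)
    refine ⟨σ, le_antisymm ?_ (hle σ)⟩
    rw [← ht, assignmentCost, Finset.sum_range]
    exact Nat.le_add_right _ _
  · refine ⟨1, le_antisymm ?_ (hle 1)⟩
    rw [← ht, assignmentCost]
    obtain ⟨k, j, hkj, hlt⟩ : ∃ k j : Fin N, s k = s j ∧ j < k := by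
      simp only [Function.Injective, not_forall] at hs
      obtain ⟨k, j, h, hne⟩ := hs
      rcases lt_or_gt_of_ne hne with h' | h'
      exacts [⟨j, k, h.symm, h'⟩, ⟨k, j, h, h'⟩]
    have h1 : 1 ≤ ∑ k ∈ Finset.range N, ∑ j ∈ Finset.range k,
        if digit N t k = digit N t j then 1 else 0 := by
      have h2 : 1 ≤ ∑ j ∈ Finset.range k, if digit N t k = digit N t j then 1 else 0 := by
        refine le_trans ?_ (Finset.single_le_sum
          (f := fun j => if digit N t k = digit N t j then 1 else 0)
          (fun _ _ => Nat.zero_le _) (Finset.mem_range.2 hlt))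
        rw [if_pos (Fin.ext_iff.1 hkj)]
      exact h2.trans (Finset.single_le_sum
        (f := fun k => ∑ j ∈ Finset.range k, if digit N t k = digit N t j then 1 else 0)
        (fun _ _ => Nat.zero_le _) (Finset.mem_range.2 k.isLt))
    calc ∑ k : Fin N, c k ((1 : Equiv.Perm (Fin N)) k)
        ≤ ∑ k ∈ Finset.range N, ∑ l ∈ Finset.range N, c k l := by
          rw [Finset.sum_range]
          refine Finset.sum_le_sum fun k _ => ?_
          exact Finset.single_le_sum (f := fun l => c k l) (fun _ _ => Nat.zero_le _)
            (Finset.mem_range.2 k.isLt)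
      _ ≤ _ := (Nat.le_mul_of_pos_right _ h1).trans (Nat.le_add_left _ _)

theorem primrec_pow : Primrec₂ ((· ^ ·) : ℕ → ℕ → ℕ) := by
  have hs : Primrec₂ fun (a : ℕ × ℕ) (s : ℕ × ℕ) => s.2 * a.1 :=
    Primrec.nat_mul.comp (Primrec.snd.comp Primrec.snd) (Primrec.fst.comp Primrec.fst)
  refine (Primrec.nat_rec' Primrec.snd (Primrec.const 1) hs).of_eq fun a => ?_
  induction a.2 with
  | zero => simp
  | succ n ih => simp [ih, pow_succ]

theorem primrec_digit : Primrec fun s : ℕ × ℕ × ℕ => digit s.1 s.2.1 s.2.2 := by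
  have h : Primrec fun s : ℕ × ℕ × ℕ => s.1 ^ s.2.2 :=
    primrec_pow.comp Primrec.fst (Primrec.snd.comp Primrec.snd)
  have h' : Primrec fun s : ℕ × ℕ × ℕ => s.2.1 / s.1 ^ s.2.2 :=
    Primrec.nat_div.comp (Primrec.fst.comp Primrec.snd) h
  exact Primrec.nat_mod.comp h' Primrec.fst

theorem computable_assignmentCost {β : Type*} [Primcodable β] {c : β → ℕ → ℕ → ℕ} {N : β → ℕ}
    (hc : Computable fun s : β × ℕ × ℕ => c s.1 s.2.1 s.2.2) (hN : Computable N) :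
    Computable₂ fun a t => assignmentCost (c a) (N a) t := by
  have hN1 : Computable fun s : β × ℕ => N s.1 := hN.comp Computable.fst
  have hN2 : Computable fun s : (β × ℕ) × ℕ => N s.1.1 := hN1.comp Computable.fst
  have hd : Computable fun s : (β × ℕ) × ℕ => digit (N s.1.1) s.1.2 s.2 :=
    have h := primrec_digit.to_comp.comp
      (hN2.pair ((Computable.snd.comp Computable.fst).pair Computable.snd))
    h
  have h1 : Computable fun s : β × ℕ =>
      ∑ k ∈ Finset.range (N s.1), c s.1 k (digit (N s.1) s.2 k) := by
    refine computable_sum_range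
      (f := fun (s : β × ℕ) k => c s.1 k (digit (N s.1) s.2 k)) ?_ hN1
    exact hc.comp ((Computable.fst.comp Computable.fst).pair (Computable.snd.pair hd))
  have h2 : Computable fun a : β =>
      ∑ k ∈ Finset.range (N a), ∑ l ∈ Finset.range (N a), c a k l := by
    refine computable_sum_range
      (f := fun (a : β) k => ∑ l ∈ Finset.range (N a), c a k l) ?_ hN
    refine computable_sum_range (f := fun (s : β × ℕ) l => c s.1 s.2 l) ?_ hN1
    exact hc.comp ((Computable.fst.comp Computable.fst).pair
      ((Computable.snd.comp Computable.fst).pair Computable.snd))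
  have h3 : Computable fun s : β × ℕ => ∑ k ∈ Finset.range (N s.1), ∑ j ∈ Finset.range k,
      if digit (N s.1) s.2 k = digit (N s.1) s.2 j then 1 else 0 := by
    refine computable_sum_range (f := fun (s : β × ℕ) k => ∑ j ∈ Finset.range k,
      if digit (N s.1) s.2 k = digit (N s.1) s.2 j then 1 else 0) ?_ hN1
    refine computable_sum_range (f := fun (s : (β × ℕ) × ℕ) j =>
      if digit (N s.1.1) s.1.2 s.2 = digit (N s.1.1) s.1.2 j then 1 else 0) ?_ Computable.snd
    have hif : Computable fun s : ℕ × ℕ => if s.1 = s.2 then 1 else 0 :=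
      (Primrec.ite (Primrec.eq.comp Primrec.fst Primrec.snd) (Primrec.const 1)
        (Primrec.const 0)).to_comp
    have hd' : Computable fun s : ((β × ℕ) × ℕ) × ℕ => digit (N s.1.1.1) s.1.1.2 s.2 :=
      have h := hd.comp ((Computable.fst.comp Computable.fst).pair Computable.snd)
      h
    exact hif.comp ((hd.comp Computable.fst).pair hd')
  exact Primrec.nat_add.to_comp.comp h1
    (Primrec.nat_mul.to_comp.comp (h2.comp Computable.fst) h3)

theorem computable_assignmentMin {β : Type*} [Primcodable β] {c : β → ℕ → ℕ → ℕ} {N : β → ℕ}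
    (hc : Computable fun s : β × ℕ × ℕ => c s.1 s.2.1 s.2.2) (hN : Computable N) :
    Computable fun a => assignmentMin (c a) (N a) :=
  computable_minUpTo (computable_assignmentCost hc hN) (primrec_pow.to_comp.comp hN hN)

/-! ### The algorithm -/

/-- The integer part of `2 ^ m` times the approximation to a distance that has the code
`f (i, j, m)`. -/
def scaledDist (f : ℕ × ℕ × ℕ → ℕ) (m i j : ℕ) : ℕ :=
  let t := Denumerable.ofNat (ℕ × ℕ × ℕ) (f (i, j, m))
  (t.1 - t.2.1) * 2 ^ m / (t.2.2 + 1)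

theorem computable_scaledDist {f : ℕ × ℕ × ℕ → ℕ} (hf : Computable f) :
    Computable fun s : ℕ × ℕ × ℕ => scaledDist f s.1 s.2.1 s.2.2 := by
  have h1 : Primrec fun s : ℕ × ℕ => Denumerable.ofNat (ℕ × ℕ × ℕ) s.2 :=
    (Primrec.ofNat (ℕ × ℕ × ℕ)).comp Primrec.snd
  have h2 : Primrec fun s : ℕ × ℕ => ((Denumerable.ofNat (ℕ × ℕ × ℕ) s.2).1 -
      (Denumerable.ofNat (ℕ × ℕ × ℕ) s.2).2.1) * 2 ^ s.1 :=
    Primrec.nat_mul.comp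
      (Primrec.nat_sub.comp (Primrec.fst.comp h1) (Primrec.fst.comp (Primrec.snd.comp h1)))
      (primrec_pow.comp (Primrec.const 2) Primrec.fst)
  have h3 : Primrec fun s : ℕ × ℕ => ((Denumerable.ofNat (ℕ × ℕ × ℕ) s.2).1 -
      (Denumerable.ofNat (ℕ × ℕ × ℕ) s.2).2.1) * 2 ^ s.1 /
      ((Denumerable.ofNat (ℕ × ℕ × ℕ) s.2).2.2 + 1) :=
    Primrec.nat_div.comp h2 (Primrec.succ.comp (Primrec.snd.comp (Primrec.snd.comp h1)))
  have h4 : Computable fun s : ℕ × ℕ × ℕ => (s.1, f (s.2.1, s.2.2, s.1)) :=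
    Computable.fst.pair (hf.comp ((Computable.fst.comp Computable.snd).pair
      ((Computable.snd.comp Computable.snd).pair Computable.fst)))
  have h5 := h3.to_comp.comp h4
  exact h5

/-- One 2⁻ᵐ comes from the given approximation, the other from the floor. Truncated subtraction
replaces a negative approximation by 0, which is closer to d ≥ 0. -/
theorem abs_scaledDist_sub_le {f : ℕ × ℕ × ℕ → ℕ} {m i j : ℕ} {d : ℝ} (hd : 0 ≤ d)
    (h : |(ratOfCode (f (i, j, m)) : ℝ) - d| ≤ (2 : ℝ)⁻¹ ^ m) :
    |(scaledDist f m i j : ℝ) / 2 ^ m - d| ≤ 2 * (2 : ℝ)⁻¹ ^ m := by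
  simp only [ratOfCode, scaledDist] at h ⊢
  generalize Denumerable.ofNat (ℕ × ℕ × ℕ) (f (i, j, m)) = t at h ⊢
  obtain ⟨a, b, c⟩ := t
  push_cast at h
  have hc : (0 : ℝ) < c + 1 := by positivity
  have hm : (0 : ℝ) < 2 ^ m := by positivity
  have h1 : |((a - b : ℕ) : ℝ) / (c + 1) - d| ≤ (2 : ℝ)⁻¹ ^ m := by
    rcases le_total b a with hab | hab
    · rwa [Nat.cast_sub hab]
    · refine le_trans ?_ h
      have h2 : ((a : ℝ) - b) / (c + 1) ≤ 0 :=
        div_nonpos_of_nonpos_of_nonneg (sub_nonpos.2 (by exact_mod_cast hab)) hc.le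
      rw [Nat.sub_eq_zero_of_le hab, Nat.cast_zero, zero_div, zero_sub, abs_neg, abs_of_nonneg hd,
        abs_of_nonpos (by linarith)]
      linarith
  have h2 : |(((a - b) * 2 ^ m / (c + 1) : ℕ) : ℝ) / 2 ^ m - ((a - b : ℕ) : ℝ) / (c + 1)| ≤
      (2 : ℝ)⁻¹ ^ m := by
    have e : (((a - b) * 2 ^ m / (c + 1) : ℕ) : ℝ) =
        ⌊((a - b : ℕ) : ℝ) / (c + 1) * 2 ^ m⌋₊ := by
      rw [← Nat.floor_div_eq_div (K := ℝ)]
      push_cast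
      congr 2
      ring
    set r : ℝ := ((a - b : ℕ) : ℝ) / (c + 1)
    have hr : 0 ≤ r * 2 ^ m := by positivity
    have e' : (⌊r * 2 ^ m⌋₊ : ℝ) / 2 ^ m - r = (⌊r * 2 ^ m⌋₊ - r * 2 ^ m) / 2 ^ m := by
      field_simp
    rw [e, e', abs_div, abs_of_pos hm, inv_pow, ← one_div]
    gcongr
    rw [abs_sub_comm, abs_of_nonneg (sub_nonneg.2 (Nat.floor_le hr))]
    linarith [Nat.lt_floor_add_one (r * 2 ^ m)]
  have := abs_add_le ((((a - b) * 2 ^ m / (c + 1) : ℕ) : ℝ) / 2 ^ m - ((a - b : ℕ) : ℝ) / (c + 1))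
    (((a - b : ℕ) : ℝ) / (c + 1) - d)
  rw [sub_add_sub_cancel] at this
  linarith

theorem primrec_indexList : Primrec indexList := by
  have h1 : Primrec (Denumerable.ofNat ((ℕ × ℕ) × List (ℕ × ℕ))) := Primrec.ofNat _
  have h2 : Primrec₂ fun (_ : ℕ) (e : ℕ × ℕ) => List.replicate (e.1 + 1) e.2 := by
    have h3 : Primrec fun s : ℕ × ℕ × ℕ => (List.range (s.2.1 + 1)).map fun _ => s.2.2 :=
      Primrec.list_map (Primrec.list_range.comp
        (Primrec.succ.comp (Primrec.fst.comp Primrec.snd)))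
        ((Primrec.snd.comp Primrec.snd).comp Primrec.fst)
    exact h3.of_eq fun s => by simp
  exact Primrec.list_flatMap
    (Primrec.list_cons.comp (Primrec.fst.comp h1) (Primrec.snd.comp h1)) h2

/-- The precision to which the measures and the distances are approximated, for the input
`(p, n)` and a space whose diameter is bounded by `2 ^ C - 2`. -/
def precision (C a : ℕ) : ℕ :=
  a.unpair.2 + a.unpair.1 + 4 + C * (a.unpair.1 + 1)

theorem primrec_precision (C : ℕ) : Primrec (precision C) := by
  have h1 : Primrec fun a : ℕ => a.unpair.1 := Primrec.fst.comp Primrec.unpair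
  have h2 : Primrec fun a : ℕ => a.unpair.2 := Primrec.snd.comp Primrec.unpair
  exact Primrec.nat_add.comp (Primrec.nat_add.comp (Primrec.nat_add.comp h2 h1)
    (Primrec.const 4)) (Primrec.nat_mul.comp (Primrec.const C) (Primrec.succ.comp h1))

/-- The cost matrix of the assignment problem for two ideal measures with the numbers `b`, `c`. -/
def costMatrix (f : ℕ × ℕ × ℕ → ℕ) (p m b c k l : ℕ) : ℕ :=
  scaledDist f m (sourceIndex b c k) (targetIndex c l) ^ p

/-- The code of an approximation to the optimal cost, computed from the input `a = (p, n)` and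
the numbers `b`, `c` of ideal measures close to the given measures. -/
def approxCost (f : ℕ × ℕ × ℕ → ℕ) (C : ℕ) (s : ℕ × ℕ × ℕ) : ℕ :=
  Encodable.encode
    (assignmentMin (costMatrix f s.1.unpair.1 (precision C s.1) s.2.1 s.2.2)
      (atomCount s.2.1 s.2.2), 0,
      atomCount s.2.1 s.2.2 * 2 ^ (precision C s.1 * s.1.unpair.1) - 1)

theorem computable_approxCost {f : ℕ × ℕ × ℕ → ℕ} (hf : Computable f) (C : ℕ) :
    Computable (approxCost f C) := by
  have hp : Primrec fun s : ℕ × ℕ × ℕ => s.1.unpair.1 :=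
    (Primrec.fst.comp Primrec.unpair).comp Primrec.fst
  have hm : Primrec fun s : ℕ × ℕ × ℕ => precision C s.1 :=
    (primrec_precision C).comp Primrec.fst
  have hb : Primrec fun s : ℕ × ℕ × ℕ => indexList s.2.1 :=
    primrec_indexList.comp (Primrec.fst.comp Primrec.snd)
  have hc : Primrec fun s : ℕ × ℕ × ℕ => indexList s.2.2 :=
    primrec_indexList.comp (Primrec.snd.comp Primrec.snd)
  have hN : Primrec fun s : ℕ × ℕ × ℕ => atomCount s.2.1 s.2.2 :=
    Primrec.nat_mul.comp (Primrec.list_length.comp hb) (Primrec.list_length.comp hc)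
  have hi : Primrec fun s : (ℕ × ℕ × ℕ) × ℕ × ℕ =>
      sourceIndex s.1.2.1 s.1.2.2 s.2.1 :=
    (Primrec.list_getD 0).comp (hb.comp Primrec.fst) (Primrec.nat_div.comp
      (Primrec.fst.comp Primrec.snd) (Primrec.list_length.comp (hc.comp Primrec.fst)))
  have hj : Primrec fun s : (ℕ × ℕ × ℕ) × ℕ × ℕ =>
      targetIndex s.1.2.2 s.2.2 :=
    (Primrec.list_getD 0).comp (hc.comp Primrec.fst) (Primrec.nat_mod.comp
      (Primrec.snd.comp Primrec.snd) (Primrec.list_length.comp (hc.comp Primrec.fst)))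
  have hM : Computable fun s : (ℕ × ℕ × ℕ) × ℕ × ℕ =>
      costMatrix f s.1.1.unpair.1 (precision C s.1.1) s.1.2.1 s.1.2.2 s.2.1 s.2.2 :=
    have h := (computable_scaledDist hf).comp
      ((hm.comp Primrec.fst).pair (hi.pair hj)).to_comp
    have h' := primrec_pow.to_comp.comp h (hp.comp Primrec.fst).to_comp
    h'
  have hV := computable_assignmentMin
    (c := fun s : ℕ × ℕ × ℕ => costMatrix f s.1.unpair.1 (precision C s.1) s.2.1 s.2.2)
    hM hN.to_comp
  have hD : Primrec fun s : ℕ × ℕ × ℕ =>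
      atomCount s.2.1 s.2.2 * 2 ^ (precision C s.1 * s.1.unpair.1) - 1 :=
    Primrec.pred.comp (Primrec.nat_mul.comp hN
      (primrec_pow.comp (Primrec.const 2) (Primrec.nat_mul.comp hm hp)))
  have h := Computable.encode.comp (hV.pair ((Computable.const 0).pair hD.to_comp))
  exact h

theorem ratOfCode_approxCost (f : ℕ × ℕ × ℕ → ℕ) (C : ℕ) (s : ℕ × ℕ × ℕ) :
    (ratOfCode (approxCost f C s) : ℝ) =
      assignmentMin (costMatrix f s.1.unpair.1 (precision C s.1) s.2.1 s.2.2)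
        (atomCount s.2.1 s.2.2) / (2 ^ precision C s.1) ^ s.1.unpair.1 /
        atomCount s.2.1 s.2.2 := by
  -- A code (a, b, c) has denominator c + 1, hence the predecessor in `approxCost`; positivity makes
  -- it exact.
  have h : 1 ≤ atomCount s.2.1 s.2.2 * 2 ^ (precision C s.1 * s.1.unpair.1) :=
    Nat.mul_pos (atomCount_pos _ _) (by positivity)
  rw [ratOfCode, approxCost, Denumerable.ofNat_encode]
  simp only [Nat.cast_sub h]
  push_cast
  rw [sub_add_cancel, sub_zero, div_div, pow_mul, mul_comm]

/-! ### Estimates -/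

/-- Since M ≥ 1, the exponent p - 1 may be raised to p, which avoids truncated subtraction later. -/
theorem abs_pow_sub_pow_le_of_le {M a b : ℝ} (hM : 1 ≤ M) (ha : |a| ≤ M) (hb : |b| ≤ M)
    (p : ℕ) : |a ^ p - b ^ p| ≤ p * M ^ p * |a - b| := by
  calc |a ^ p - b ^ p| ≤ |a - b| * p * max |a| |b| ^ (p - 1) := abs_pow_sub_pow_le a b p
    _ ≤ |a - b| * p * M ^ p := by
        gcongr
        calc max |a| |b| ^ (p - 1) ≤ M ^ (p - 1) := by gcongr; exact max_le ha hb
          _ ≤ M ^ p := pow_le_pow_right₀ hM (Nat.sub_le _ _)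
    _ = _ := by ring

theorem abs_sub_le_of_isLeast {ι : Type*} {a b : ι → ℝ} {A B e : ℝ}
    (hA : IsLeast (Set.range a) A) (hB : IsLeast (Set.range b) B)
    (h : ∀ i, |a i - b i| ≤ e) : |A - B| ≤ e := by
  obtain ⟨⟨i, rfl⟩, hA⟩ := hA
  obtain ⟨⟨j, rfl⟩, hB⟩ := hB
  have h1 := abs_le.1 (h i)
  have h2 := abs_le.1 (h j)
  have h3 := hA ⟨j, rfl⟩
  have h4 := hB ⟨i, rfl⟩
  exact abs_le.2 ⟨by linarith, by linarith⟩

/-- The first term is the error from rounded distances, the second that from the two splittings with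
δ = 2τ. Together they are at most 14 * p * M ^ (p + 1) * τ, and 14 ≤ 2 ^ 4, p ≤ 2 ^ p, M = 2 ^ C
explain the exponent in `precision`. -/
theorem error_le (C p n : ℕ) {M τ : ℝ} (hM : M = 2 ^ C)
    (hτ : τ = (2 : ℝ)⁻¹ ^ (n + p + 4 + C * (p + 1))) :
    p * M ^ p * (2 * τ) + p * M ^ p * (3 * M * (2 * τ) + 3 * M * (2 * τ)) ≤ (2 : ℝ)⁻¹ ^ n := by
  have hp : (p : ℝ) ≤ 2 ^ p := by exact_mod_cast Nat.lt_two_pow_self.le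
  have hM1 : 1 ≤ M := hM ▸ one_le_pow₀ one_le_two
  have hτ0 : 0 ≤ τ := hτ ▸ by positivity
  calc p * M ^ p * (2 * τ) + p * M ^ p * (3 * M * (2 * τ) + 3 * M * (2 * τ))
      ≤ p * M ^ p * (2 * M * τ) + p * M ^ p * (3 * M * (2 * τ) + 3 * M * (2 * τ)) := by
        gcongr
        linarith
    _ = 14 * p * M ^ (p + 1) * τ := by ring
    _ ≤ 2 ^ 4 * 2 ^ p * M ^ (p + 1) * τ := by
        gcongr
        norm_num
    _ = (2 : ℝ)⁻¹ ^ n := by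
        rw [hM, hτ, ← pow_mul, pow_add _ _ (C * (p + 1)), pow_add _ (n + p), pow_add _ n]
        simp only [inv_pow]
        field_simp

theorem abs_ratOfCode_approxCost_sub_le {X : Type*} [MetricSpace X] [BoundedSpace X]
    [MeasurableSpace X] [BorelSpace X] [SecondCountableTopology X] {α : ℕ → X}
    {f : ℕ × ℕ × ℕ → ℕ}
    (hf : ∀ i j n : ℕ, |(ratOfCode (f (i, j, n)) : ℝ) - dist (α i) (α j)| ≤ (2 : ℝ)⁻¹ ^ n)
    {C : ℕ} (hC : ∀ u v : X, dist u v + 2 ≤ 2 ^ C) (p n : ℕ) {μ ν : ProbabilityMeasure X}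
    {b c : ℕ}
    (hμ : levyProkhorovDist (idealMeasure α b) (μ : Measure X) ≤
      (2 : ℝ)⁻¹ ^ precision C (Nat.pair p n))
    (hν : levyProkhorovDist (idealMeasure α c) (ν : Measure X) ≤
      (2 : ℝ)⁻¹ ^ precision C (Nat.pair p n)) :
    |(ratOfCode (approxCost f C (Nat.pair p n, b, c)) : ℝ) -
      optimalCost (fun x y => dist x y ^ p) μ ν| ≤ (2 : ℝ)⁻¹ ^ n := by
  rw [ratOfCode_approxCost]
  simp only [Nat.unpair_pair]
  have hm : precision C (Nat.pair p n) = n + p + 4 + C * (p + 1) := by simp [precision]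
  set m := precision C (Nat.pair p n)
  set M : ℝ := 2 ^ C
  set τ : ℝ := (2 : ℝ)⁻¹ ^ m
  have hτ : 0 < τ := by positivity
  have hτ1 : τ ≤ 1 := pow_le_one₀ (by norm_num) (by norm_num)
  have hM2 : 2 ≤ M := by simpa using hC (α 0) (α 0)
  have hM1 : 1 ≤ M := by linarith
  have hdM (u v : X) : dist u v ≤ M := by linarith [hC u v]
  have hN := atomCount_pos b c
  have : Nonempty (Fin (atomCount b c)) := Fin.pos_iff_nonempty.1 hN
  have hN' : (0 : ℝ) < atomCount b c := by exact_mod_cast hN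
  let x : Fin (atomCount b c) → X := fun k => α (sourceIndex b c k)
  let y : Fin (atomCount b c) → X := fun k => α (targetIndex c k)
  replace hμ : levyProkhorovDist (uniformMeasure x) μ ≤ τ := by
    rw [idealMeasure_eq_source α b c] at hμ
    exact hμ
  replace hν : levyProkhorovDist (uniformMeasure y) ν ≤ τ := by
    rw [idealMeasure_eq_target α b c] at hν
    exact hν
  -- A Cauchy name gives only distance ≤ τ; doubling makes the inequality strict.
  obtain ⟨φ, hφ⟩ := exists_isSplitting_of_levyProkhorovDist_lt (x := x) (δ := 2 * τ) hdM hM1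
    (hμ.trans_lt (by linarith))
  obtain ⟨ψ, hψ⟩ := exists_isSplitting_of_levyProkhorovDist_lt (x := y) (δ := 2 * τ) hdM hM1
    (hν.trans_lt (by linarith))
  obtain ⟨V, hV⟩ : ∃ V, IsLeast
      (Set.range fun σ : Equiv.Perm (Fin (atomCount b c)) => ∑ k, dist (x k) (y (σ k)) ^ p) V :=
    (Set.finite_range _).isCompact.exists_isLeast (Set.range_nonempty _)
  have habs (u v : X) : |dist u v| ≤ M := by rw [abs_of_nonneg dist_nonneg]; exact hdM u v
  have h1 := abs_optimalCost_sub_le hφ hψ (c := fun u v => dist u v ^ p) (B := M ^ p)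
    (L := p * M ^ p) (V := V) (by fun_prop) (fun u v => by positivity)
    (fun u v => pow_le_pow_left₀ dist_nonneg (hdM u v) p) (by positivity)
    (fun u v u' v' => (abs_pow_sub_pow_le_of_le hM1 (habs u v) (habs u' v') p).trans (by
      gcongr
      exact dist_dist_dist_le u v u' v')) hV
  rw [Fintype.card_fin] at h1
  set A := assignmentMin (costMatrix f p m b c) (atomCount b c) with hA
  have h2 : IsLeast (Set.range fun σ : Equiv.Perm (Fin (atomCount b c)) =>
      (∑ k : Fin (atomCount b c), (costMatrix f p m b c k (σ k) : ℝ)) / (2 ^ m) ^ p)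
      (A / (2 ^ m) ^ p) := by
    obtain ⟨⟨σ, hσ⟩, hle⟩ := isLeast_assignmentMin (costMatrix f p m b c) hN
    refine ⟨⟨σ, ?_⟩, ?_⟩
    · rw [hA, ← hσ]
      push_cast
      rfl
    · rintro _ ⟨σ', rfl⟩
      have h3 := hle ⟨σ', rfl⟩
      have h4 : (A : ℝ) ≤ ∑ k : Fin (atomCount b c), (costMatrix f p m b c k (σ' k) : ℝ) := by
        exact_mod_cast h3
      simp only
      gcongr
  have h3 := abs_sub_le_of_isLeast h2 hV (e := atomCount b c * (p * M ^ p * (2 * τ))) fun σ => by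
    rw [Finset.sum_div, ← Finset.sum_sub_distrib]
    refine (Finset.abs_sum_le_sum_abs _ _).trans ?_
    refine (Finset.sum_le_card_nsmul _ _ (p * M ^ p * (2 * τ)) fun k _ => ?_).trans_eq (by simp)
    have h4 := abs_scaledDist_sub_le dist_nonneg
      (hf (sourceIndex b c k) (targetIndex c (σ k)) m)
    rw [costMatrix, Nat.cast_pow, ← div_pow]
    refine (abs_pow_sub_pow_le_of_le hM1 ?_ (habs _ _) p).trans (by
      gcongr)
    have h5 : _ ≤ 2 * τ := (abs_le.1 h4).2
    rw [abs_of_nonneg (by positivity)]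
    -- The slack 2 in `hC` absorbs the error 2τ ≤ 2, so rounded distances are also bounded by M.
    have h6 := hC (α (sourceIndex b c k)) (α (targetIndex c (σ k)))
    linarith
  have h4 : |(A : ℝ) / (2 ^ m) ^ p / atomCount b c - V / atomCount b c| ≤
      p * M ^ p * (2 * τ) := by
    rw [← sub_div, abs_div, abs_of_pos hN', div_le_iff₀ hN', mul_comm _ (atomCount b c : ℝ)]
    exact h3
  rw [abs_sub_comm] at h1
  have h5 := (abs_sub_le _ _ _).trans (add_le_add h4 h1)
  refine h5.trans ?_
  exact error_le C p n rfl (congrArg (fun k => (2 : ℝ)⁻¹ ^ k) hm)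

end UniformTransport


theorem mainTheorem6 {X : Type*} [MetricSpace X] [CompleteSpace X] [BoundedSpace X]
    [MeasurableSpace X] [BorelSpace X] (α : ℕ → X)
    (hα : UniformTransport.IsComputableMetricSpace α) :
    ∃ F : (Fin 2 → ℕ → ℕ) → ℕ →. ℕ, UniformTransport.RecursiveFunctional F ∧
      ∀ (p : ℕ), 1 ≤ p → ∀ (μ ν : ProbabilityMeasure X) (g h : ℕ → ℕ),
        UniformTransport.IsCauchyName α μ g → UniformTransport.IsCauchyName α ν h →
        ∀ n : ℕ, ∃ e ∈ F ![g, h] (Nat.pair p n),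
          |(UniformTransport.ratOfCode e : ℝ) -
            UniformTransport.optimalCost (fun x y => dist x y ^ p) μ ν| ≤ (2 : ℝ)⁻¹ ^ n := by
  obtain ⟨f, hf, hfd⟩ := hα.computable_dist
  have : TopologicalSpace.SeparableSpace X := ⟨_, Set.countable_range α, hα.dense⟩
  have : SecondCountableTopology X := UniformSpace.secondCountable_of_separable X
  -- C depends only on the space, so it can be built into the program as a constant.
  obtain ⟨C, hC⟩ := pow_unbounded_of_one_lt (Metric.diam (Set.univ : Set X) + 2)
    (one_lt_two : (1 : ℝ) < 2)
  have hC' (u v : X) : dist u v + 2 ≤ 2 ^ C :=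
    (add_le_add_left (Metric.dist_le_diam_of_mem BoundedSpace.bounded_univ trivial trivial)
      2).trans hC.le
  exact ⟨_, UniformTransport.RecursiveFunctional.of_two_queries (UniformTransport.computable_approxCost hf C)
    (UniformTransport.primrec_precision C).to_comp, fun p _ μ ν g h hg hh n =>
    ⟨_, Part.mem_some _, UniformTransport.abs_ratOfCode_approxCost_sub_le hfd hC' p n
      (hg _) (hh _)⟩⟩
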